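/- **Setting.** Let $d\ge 1$ and let $\Omega\subset\mathbb R^d$ be open, bounded and connected with Lipschitz boundary; let $\Sigma_{\mathrm v},\Sigma_{\mathrm p}\subset\partial\Omega$ be disjoint and relatively open with $\partial\Omega=\overline{\Sigma_{\mathrm v}\cup\Sigma_{\mathrm p}}$. Let $r\ge 2$ and $s=r/(r-1)$. Let $\varphi_1$ be continuous, non-negative and non-decreasing on $[0,1]$ and positive on $(0,1)$, let $\varphi_2$ be continuous and non-decreasing on $[1,\infty)$, and suppose that there are $c,C>0$ with $$c\,a^{\frac{r-2}{2}}\le \varphi_2(a)\le C\bigl(1+a^{\frac{r-2}{2}}\bigr)\qquad\text{for all } a\ge 1.$$ Put $\lambda_1=\varphi_1(1)$, $\lambda_2=\varphi_2(1)$, and let $\Psi(a)=\int_1^a\frac{\varphi_1(t)}2\,dt$ for $0\le a\le 1$, $\Psi(a)=\int_1^a\frac{\varphi_2(t)}2\,dt$ for $a>1$. Let $W^{1,s}_0(\Omega)$ be the set of $\psi\in W^{1,s}(\Omega)$ with $\int_\Omega\psi=0$ if $\Sigma_{\mathrm p}$ has zero $(d-1)$-dimensional measure, and with zero trace on $\Sigma_{\mathrm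 p}$ otherwise. Write $L^r(\Omega)$, $L^s(\Omega)$ for spaces of $\mathbb R^d$-valued fields, $\langle g,\varphi\rangle=\int_\Omega g\cdot\varphi$ for $g\in L^s(\Omega)$, $\varphi\in L^r(\Omega)$, and $$V=\{\varphi\in L^r(\Omega):\ \langle\nabla\psi,\varphi\rangle=0\ \text{ for all }\psi\in W^{1,s}_0(\Omega)\}.$$ Let $f_0\in L^s(\Omega)$, $\hat u\in L^r(\Omega)$, and $$\mathcal E(v)=\int_\Omega\Psi(|v+\hat u|^2)-\langle f_0,v+\hat u\rangle\qquad(v\in V).$$ A point $v\in V$ is a *local minimizer* of $\mathcal E$ if there is $\eta>0$ such that $\mathcal E(v+\delta\varphi)\ge\mathcal E(v)$ for all $\varphi\in V$ and $\delta\in[0,\eta)$. **Theorem 4.1 (existence and uniqueness when $\lambda_1\le\lambda_2$).** Suppose that $\lambda_1\le\lambda_2$. Then the integrals defining $\mathcal E(v)$ converge for every $v\in V$, and $\mathcal E$ has exactly one local minimizer $v$ in $V$; it is a global minimizer. Uniqueness holds even among those $v$ for which $\eta$ is allowed to depend on the direction $\varphi$. Moreover: 1. $v$ solves the weak problem reduced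 to the velocity: there are $h\in L^s(\Omega)$ and $\Lambda_v\in L^s(\Omega)$ such that a.e., with $u=v+\hat u$, $\Lambda_v=\varphi_1(|u|^2)u$ where $|u|<1$, $\Lambda_v=\varphi_2(|u|^2)u$ where $|u|>1$ and $\Lambda_v=h$ where $|u|=1$, and $\langle\Lambda_v,\varphi\rangle=\langle f_0,\varphi\rangle$ for all $\varphi\in V$. 2. Let $q\in L^r(\Omega)$ and $u_0\in L^r(\Sigma_{\mathrm v})$ be scalar functions. If $w=\hat u$ satisfies $\langle\nabla\psi,w\rangle=-\int_\Omega q\psi+\int_{\Sigma_{\mathrm v}}u_0\psi$ for all $\psi\in W^{1,s}_0(\Omega)$, then so does $w=v+\hat u$. -/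

import Mathlib

open MeasureTheory Set Filter Topology
open scoped ENNReal ContDiff

noncomputable section

namespace AdaptiveDarcy

/-- `ℝ^d` with its Euclidean norm. -/
abbrev Space (d : ℕ) : Type := EuclideanSpace ℝ (Fin d)

/-- The space `L^r(Ω)^d` of classes of vector fields. -/
abbrev VecLp {d : ℕ} (Ω : Set (Space d)) (r : ℝ) : Type :=
  Lp (Space d) (ENNReal.ofReal r) (volume.restrict Ω)

/-- The conjugate exponent `s = r / (r - 1)`. -/
def conjExp (r : ℝ) : ℝ := r / (r - 1)

/-! ### The domain and its boundary -/

/-- `Ω` has a Lipschitz boundary: near each boundary point, `Ω` is the open epigraph, in some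
direction `e`, of a Lipschitz function of the component orthogonal to `e`. -/
def HasLipschitzBoundary {d : ℕ} (Ω : Set (Space d)) : Prop :=
  ∀ x ∈ frontier Ω, ∃ (e : Space d) (ρ : ℝ) (K : NNReal) (γ : Space d → ℝ),
    ‖e‖ = 1 ∧ 0 < ρ ∧ LipschitzWith K γ ∧
      ∀ y ∈ Metric.ball x ρ, (y ∈ Ω ↔ γ (y - inner ℝ e y • e) < inner ℝ e y)

/-- `S` is a relatively open subset of `∂Ω`. -/
def IsRelOpenInBoundary {d : ℕ} (Ω S : Set (Space d)) : Prop :=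
  ∃ O : Set (Space d), IsOpen O ∧ S = O ∩ frontier Ω

/-- A fracture `Ω` with its velocity boundary `Sv` and its pressure boundary `Sp`. -/
structure IsFracture {d : ℕ} (Ω Sv Sp : Set (Space d)) : Prop where
  isOpen : IsOpen Ω
  isBounded : Bornology.IsBounded Ω
  isConnected : IsConnected Ω
  lipschitz : HasLipschitzBoundary Ω
  relOpen_v : IsRelOpenInBoundary Ω Sv
  relOpen_p : IsRelOpenInBoundary Ω Sp
  cover : frontier Ω = closure (Sv ∪ Sp)
  disj : Disjoint Sv Sp

/-- The `(d-1)`-dimensional surface measure on `ℝ^d`. -/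
def surface (d : ℕ) : Measure (Space d) := Measure.euclideanHausdorffMeasure (d - 1)

/-! ### Sobolev functions and traces -/

/-- `G` is the weak gradient of `ξ` in `Ω`. -/
def HasWeakGradient {d : ℕ} (Ω : Set (Space d)) (ξ : Space d → ℝ) (G : Space d → Space d) :
    Prop :=
  ∀ η : Space d → ℝ, ContDiff ℝ ∞ η → HasCompactSupport η → tsupport η ⊆ Ω →
    ∀ y : Space d, ∫ x in Ω, ξ x * fderiv ℝ η x y = -∫ x in Ω, inner ℝ (G x) y * η x

/-- `ξ ∈ W^{1,s}(Ω)`, with weak gradient `G`. -/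
structure IsSobolev {d : ℕ} (Ω : Set (Space d)) (s : ℝ) (ξ : Space d → ℝ)
    (G : Space d → Space d) : Prop where
  memLp : MemLp ξ (ENNReal.ofReal s) (volume.restrict Ω)
  memLp_grad : MemLp G (ENNReal.ofReal s) (volume.restrict Ω)
  weak : HasWeakGradient Ω ξ G

/-- `g` is the trace on `S ⊆ ∂Ω` of the Sobolev function `ξ` with weak gradient `G`: there are
smooth functions on `ℝ^d` that converge to `ξ` in `W^{1,s}(Ω)` and to `g` in `L^s(S)`. -/
def HasTrace {d : ℕ} (Ω S : Set (Space d)) (s : ℝ) (ξ : Space d → ℝ) (G : Space d → Space d)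
    (g : Space d → ℝ) : Prop :=
  MemLp g (ENNReal.ofReal s) ((surface d).restrict S) ∧
  ∃ ζ : ℕ → Space d → ℝ, (∀ n, ContDiff ℝ ∞ (ζ n)) ∧
    Tendsto (fun n => eLpNorm (fun x => ζ n x - ξ x) (ENNReal.ofReal s) (volume.restrict Ω))
      atTop (𝓝 0) ∧
    Tendsto (fun n => eLpNorm (fun x => gradient (ζ n) x - G x) (ENNReal.ofReal s)
      (volume.restrict Ω)) atTop (𝓝 0) ∧
    Tendsto (fun n => eLpNorm (fun x => ζ n x - g x) (ENNReal.ofReal s)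
      ((surface d).restrict S)) atTop (𝓝 0)

/-- `ψ ∈ W_0^{1,s}(Ω)`, with weak gradient `G`: zero mean if `Sp` has zero surface measure, and
zero trace on `Sp` otherwise. -/
structure MemW0 {d : ℕ} (Ω Sp : Set (Space d)) (s : ℝ) (ψ : Space d → ℝ)
    (G : Space d → Space d) : Prop where
  isSobolev : IsSobolev Ω s ψ G
  mean : surface d Sp = 0 → ∫ x in Ω, ψ x = 0
  trace : surface d Sp ≠ 0 → HasTrace Ω Sp s ψ G (fun _ => 0)

/-- The pairing `⟨g, φ⟩ = ∫_Ω g · φ`. -/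
def pairing {d : ℕ} (Ω : Set (Space d)) (g φ : Space d → Space d) : ℝ :=
  ∫ x in Ω, inner ℝ (g x) (φ x)

theorem integrable_inner_of_conj {d : ℕ} (Ω : Set (Space d)) {r : ℝ} (hr : 2 ≤ r)
    {g φ : Space d → Space d}
    (hg : MemLp g (ENNReal.ofReal (conjExp r)) (volume.restrict Ω))
    (hφ : MemLp φ (ENNReal.ofReal r) (volume.restrict Ω)) :
    Integrable (fun x => (inner ℝ (g x) (φ x) : ℝ)) (volume.restrict Ω) := by
  have h1 : r.HolderConjugate (conjExp r) := Real.HolderConjugate.conjExponent (by linarith)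
  have : ENNReal.HolderConjugate (ENNReal.ofReal (conjExp r)) (ENNReal.ofReal r) :=
    h1.symm.ennrealOfReal
  rw [← memLp_one_iff_integrable]
  refine MemLp.of_bilin (r := 1) (fun a b => (inner ℝ a b : ℝ)) 1 hg hφ
    (hg.1.inner hφ.1) (Eventually.of_forall fun x => ?_)
  have h := norm_inner_le_norm (𝕜 := ℝ) (g x) (φ x)
  rw [one_mul]
  exact_mod_cast h

/-- The space `V` of the fields of `L^r(Ω)` that are orthogonal to all the gradients of functions of
`W_0^{1,s}(Ω)`. -/
def V {d : ℕ} (Ω Sp : Set (Space d)) (r : ℝ) (hr : 2 ≤ r) : Submodule ℝ (VecLp Ω r) where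
  carrier := {φ | ∀ (ψ : Space d → ℝ) (G : Space d → Space d),
    MemW0 Ω Sp (conjExp r) ψ G → pairing Ω G φ = 0}
  zero_mem' := by
    intro ψ G _
    have h : pairing Ω G ((0 : VecLp Ω r) : Space d → Space d) = ∫ x in Ω, (0 : ℝ) := by
      refine integral_congr_ae ?_
      filter_upwards [Lp.coeFn_zero (Space d) (ENNReal.ofReal r) (volume.restrict Ω)] with x hx
      rw [hx, Pi.zero_apply, inner_zero_right]
    simpa using h
  add_mem' := by
    intro a b ha hb ψ G hψ
    have h : pairing Ω G ((a + b : VecLp Ω r) : Space d → Space d)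
        = ∫ x in Ω, ((inner ℝ (G x) (a x) : ℝ) + inner ℝ (G x) (b x)) := by
      refine integral_congr_ae ?_
      filter_upwards [Lp.coeFn_add a b] with x hx
      rw [hx, Pi.add_apply, inner_add_right]
    rw [h, integral_add
      (integrable_inner_of_conj Ω hr hψ.isSobolev.memLp_grad (Lp.memLp a))
      (integrable_inner_of_conj Ω hr hψ.isSobolev.memLp_grad (Lp.memLp b))]
    have h1 := ha ψ G hψ
    have h2 := hb ψ G hψ
    unfold pairing at h1 h2
    rw [h1, h2, add_zero]
  smul_mem' := by
    intro t a ha ψ G hψ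
    have h : pairing Ω G ((t • a : VecLp Ω r) : Space d → Space d)
        = ∫ x in Ω, t * (inner ℝ (G x) (a x) : ℝ) := by
      refine integral_congr_ae ?_
      filter_upwards [Lp.coeFn_smul t a] with x hx
      rw [hx, Pi.smul_apply, inner_smul_right]
    have h1 := ha ψ G hψ
    unfold pairing at h1
    rw [h, integral_const_mul, h1, mul_zero]

/-- The weak form of `div u = q` in `Ω`, `u · n = u₀` on `Sv`. -/
def HasFluxData {d : ℕ} (Ω Sv Sp : Set (Space d)) (r : ℝ) (q u₀ : Space d → ℝ)
    (u : VecLp Ω r) : Prop :=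
  ∀ (ψ : Space d → ℝ) (G : Space d → Space d) (g : Space d → ℝ),
    MemW0 Ω Sp (conjExp r) ψ G → HasTrace Ω Sv (conjExp r) ψ G g →
      pairing Ω G u = -(∫ x in Ω, q x * ψ x) + ∫ x in Sv, u₀ x * g x ∂(surface d)

/-! ### The laws, the energy, minimizers -/

/-- The assumptions on the low-speed law `φ₁` (used on `[0,1]`) and on the high-speed law `φ₂`
(used on `[1,∞)`). -/
structure AdmissibleLaws (r : ℝ) (φ₁ φ₂ : ℝ → ℝ) : Prop where
  nonneg₁ : ∀ a ∈ Icc (0 : ℝ) 1, 0 ≤ φ₁ a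
  pos₁ : ∀ a ∈ Ioo (0 : ℝ) 1, 0 < φ₁ a
  continuous₁ : ContinuousOn φ₁ (Icc 0 1)
  monotone₁ : MonotoneOn φ₁ (Icc 0 1)
  continuous₂ : ContinuousOn φ₂ (Ici 1)
  monotone₂ : MonotoneOn φ₂ (Ici 1)
  growth : ∃ c C : ℝ, 0 < c ∧ 0 < C ∧ ∀ a : ℝ, 1 ≤ a →
    c * a ^ ((r - 2) / 2) ≤ φ₂ a ∧ φ₂ a ≤ C * (1 + a ^ ((r - 2) / 2))

/-- The primitive of `φ / 2` that vanishes at `1`. -/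
def primitive (φ : ℝ → ℝ) (a : ℝ) : ℝ := ∫ t in (1 : ℝ)..a, φ t / 2

/-- The energy density `Ψ`. -/
def Psi (φ₁ φ₂ : ℝ → ℝ) (a : ℝ) : ℝ := if a ≤ 1 then primitive φ₁ a else primitive φ₂ a

/-- The dissipation `v ↦ ∫_Ω Ψ(|v + û|²)`. -/
def dissipation {d : ℕ} {Ω : Set (Space d)} {r : ℝ} {W : Submodule ℝ (VecLp Ω r)}
    (φ₁ φ₂ : ℝ → ℝ) (uhat : VecLp Ω r) (v : W) : ℝ :=
  ∫ x in Ω, Psi φ₁ φ₂ (‖((v : VecLp Ω r) + uhat) x‖ ^ 2)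

/-- The energy `v ↦ ∫_Ω Ψ(|v + û|²) - ⟨f₀, v + û⟩`. -/
def energy {d : ℕ} {Ω : Set (Space d)} {r : ℝ} {W : Submodule ℝ (VecLp Ω r)}
    (φ₁ φ₂ : ℝ → ℝ) (f₀ : VecLp Ω (conjExp r)) (uhat : VecLp Ω r) (v : W) : ℝ :=
  dissipation φ₁ φ₂ uhat v - pairing Ω f₀ ((v : VecLp Ω r) + uhat : VecLp Ω r)

/-- Strong local minimizers: one `η` serves all directions `φ`. -/
def IsStrongLocalMinimizer {W : Type*} [AddCommGroup W] [Module ℝ W] (F : W → ℝ) (v : W) : Prop :=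
  ∃ η : ℝ, 0 < η ∧ ∀ φ : W, ∀ δ ∈ Ico (0 : ℝ) η, F v ≤ F (v + δ • φ)

/-- Directional local minimizers: `η` may depend on the direction. Global minimizers, local
minimizers for a vector space topology and strong local minimizers are all of this kind. -/
def IsDirectionalLocalMinimizer {W : Type*} [AddCommGroup W] [Module ℝ W] (F : W → ℝ) (v : W) :
    Prop :=
  ∀ φ : W, ∃ η : ℝ, 0 < η ∧ ∀ δ ∈ Ico (0 : ℝ) η, F v ≤ F (v + δ • φ)

/-! ### The multi-valued law -/

/-- The field `φ₁(|u|²) u` where `|u| < 1`, `φ₂(|u|²) u` where `|u| > 1`, and `0` where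
`|u| = 1`. -/
def bulkLaw {d : ℕ} (φ₁ φ₂ : ℝ → ℝ) (u : Space d → Space d) (x : Space d) : Space d :=
  {y | ‖u y‖ < 1}.indicator (fun y => φ₁ (‖u y‖ ^ 2) • u y) x +
    {y | 1 < ‖u y‖}.indicator (fun y => φ₂ (‖u y‖ ^ 2) • u y) x

/-- The multi-valued law `Λ(u) ⊆ L^s(Ω)`: arbitrary on the interface `|u| = 1`. -/
def combinedLaw {d : ℕ} {Ω : Set (Space d)} {r : ℝ} (φ₁ φ₂ : ℝ → ℝ) (u : VecLp Ω r) :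
    Set (VecLp Ω (conjExp r)) :=
  {g | ∃ h : VecLp Ω (conjExp r), ∀ᵐ x ∂(volume.restrict Ω),
    g x = bulkLaw φ₁ φ₂ u x + {y | ‖u y‖ = 1}.indicator (fun y => h y) x}

/-- `v` solves the weak problem reduced to the velocity: some selection `Λ_v ∈ Λ(v + û)` satisfies
`⟨Λ_v, φ⟩ = ⟨f₀, φ⟩` for all `φ ∈ W`. -/
def SolvesReducedProblem {d : ℕ} {Ω : Set (Space d)} {r : ℝ} {W : Submodule ℝ (VecLp Ω r)}
    (φ₁ φ₂ : ℝ → ℝ) (f₀ : VecLp Ω (conjExp r)) (uhat : VecLp Ω r) (v : W) : Prop :=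
  ∃ g ∈ combinedLaw φ₁ φ₂ ((v : VecLp Ω r) + uhat),
    ∀ φ : W, pairing Ω g (φ : VecLp Ω r) = pairing Ω f₀ (φ : VecLp Ω r)

end AdaptiveDarcy

end

/-! ### Pointwise convexity: the joined law and its primitive. -/

namespace AdaptiveDarcy

/-! When `φ₁ 1 ≤ φ₂ 1` the two laws join to a monotone law, so its primitive `P` (equal to `Ψ` on
`[0,∞)`) is convex and nondecreasing, and `z ↦ P(|z|²)` is convex. More is true: `P - P(0)` is
superadditive, and with the parallelogram law this makes the convexity uniform: the midpoint of `z`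
and `w` gains at least `P(|z-w|²/4) - P(0)` (`lawPrimitive_midpoint`). By the lower growth bound
this gain controls `|z-w|^r`, up to an arbitrarily small error near zero (`rpow_le_lawPrimitive`).

After integration, two fields whose energies are close to a lower bound for the energy of their
midpoint are close in `L^r` (`totalEnergy_near`). Minimizing sequences are therefore Cauchy, without
weak compactness, and a continuous affine minorant that touches the energy at the limit shows that
the limit is a minimizer. The same estimate gives uniqueness, and convexity along segments makes
every directional local minimizer global.

For the Euler-Lagrange equation only the set `|u| = 1` is delicate, because the law jumps there. The
one-sided derivative of the dissipation is at most the bulk term plus `φ₂(1) ∫ |φ|` over that set.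
Testing with `φ` and `-φ` bounds the residual linear form by the `L²` norm of `φ` on the interface.
Hahn-Banach and Riesz in `L²` then produce the multiplier `h`, which lies in `L^s` because `s ≤ 2`
and `Ω` has finite measure. -/

/-- The laws `φ₁` and `φ₂` joined into one function on `ℝ`, with the value `φ₂ 1` at `1`. -/
noncomputable def law (φ₁ φ₂ : ℝ → ℝ) (a : ℝ) : ℝ := if a < 1 then φ₁ (max a 0) else φ₂ a

theorem law_of_lt {φ₁ φ₂ : ℝ → ℝ} {a : ℝ} (h0 : 0 ≤ a) (h : a < 1) : law φ₁ φ₂ a = φ₁ a := by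
  simp [law, h, h0]

theorem law_of_ge {φ₁ φ₂ : ℝ → ℝ} {a : ℝ} (h : 1 ≤ a) : law φ₁ φ₂ a = φ₂ a := by
  simp [law, not_lt.2 h]

namespace AdmissibleLaws

variable {r : ℝ} {φ₁ φ₂ : ℝ → ℝ}

/-- This is where `φ₁ 1 ≤ φ₂ 1` enters: the jump at `1` goes upward. The cutoff `max a 0` extends
monotonicity to all of `ℝ`, which yields measurability and interval integrability. -/
theorem law_mono (h : AdmissibleLaws r φ₁ φ₂) (hlam : φ₁ 1 ≤ φ₂ 1) : Monotone (law φ₁ φ₂) := by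
  intro a b hab
  unfold law
  split_ifs with ha hb hb
  · exact h.monotone₁ ⟨le_max_right _ _, by simp [ha.le]⟩ ⟨le_max_right _ _, by simp [hb.le]⟩
      (max_le_max_right 0 hab)
  · have h1 : φ₁ (max a 0) ≤ φ₁ 1 := h.monotone₁ ⟨le_max_right _ _, by simp [ha.le]⟩
      ⟨zero_le_one, le_rfl⟩ (by simp [ha.le])
    have h2 : φ₂ 1 ≤ φ₂ b := h.monotone₂ self_mem_Ici (not_lt.1 hb) (not_lt.1 hb)
    linarith
  · linarith
  · exact h.monotone₂ (not_lt.1 ha) (not_lt.1 hb) hab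

theorem law_nonneg (h : AdmissibleLaws r φ₁ φ₂) (hlam : φ₁ 1 ≤ φ₂ 1) (a : ℝ) :
    0 ≤ law φ₁ φ₂ a := by
  have h1 : 0 ≤ law φ₁ φ₂ (min a 0) := by
    have : law φ₁ φ₂ (min a 0) = φ₁ 0 := by
      have : min a 0 < 1 := lt_of_le_of_lt (min_le_right _ _) one_pos
      simp [law, this]
    rw [this]
    exact h.nonneg₁ 0 ⟨le_rfl, zero_le_one⟩
  exact h1.trans (h.law_mono hlam (min_le_left _ _))

theorem law_pos (h : AdmissibleLaws r φ₁ φ₂) (hlam : φ₁ 1 ≤ φ₂ 1) {a : ℝ} (ha : 0 < a) :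
    0 < law φ₁ φ₂ a := by
  have hm : min a (1 / 2) ∈ Ioo (0 : ℝ) 1 :=
    ⟨lt_min ha (by norm_num), lt_of_le_of_lt (min_le_right _ _) (by norm_num)⟩
  have h1 := h.pos₁ _ hm
  rw [← law_of_lt (φ₁ := φ₁) (φ₂ := φ₂) hm.1.le hm.2] at h1
  exact h1.trans_le (h.law_mono hlam (min_le_left _ _))

theorem law_intervalIntegrable (h : AdmissibleLaws r φ₁ φ₂) (hlam : φ₁ 1 ≤ φ₂ 1) (a b : ℝ) :
    IntervalIntegrable (fun t => law φ₁ φ₂ t / 2) volume a b :=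
  ((h.law_mono hlam).intervalIntegrable).div_const 2

theorem law_continuousAt (h : AdmissibleLaws r φ₁ φ₂) {a : ℝ} (ha : a ≠ 1) :
    ContinuousAt (law φ₁ φ₂) a := by
  rcases lt_or_gt_of_ne ha with ha | ha
  · have h1 : ContinuousOn (fun t => φ₁ (max t 0)) (Iio 1) :=
      h.continuous₁.comp (by fun_prop) fun t ht => ⟨le_max_right _ _, by simp [(mem_Iio.1 ht).le]⟩
    refine (h1.continuousAt (Iio_mem_nhds ha)).congr ?_
    filter_upwards [Iio_mem_nhds ha] with t ht
    simp [law, mem_Iio.1 ht]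
  · refine (h.continuous₂.continuousAt (Ici_mem_nhds ha)).congr ?_
    filter_upwards [Ici_mem_nhds ha] with t ht
    rw [law_of_ge ht]

/-- Assigning the value `φ₂ 1` at the jump makes the law right-continuous there; the limit of
`slopeBound` on the interface relies on this. -/
theorem law_continuousOn (h : AdmissibleLaws r φ₁ φ₂) : ContinuousOn (law φ₁ φ₂) (Ici 1) :=
  h.continuous₂.congr fun _ ht => law_of_ge ht

/-- Growth of the joined law, in terms of the speed. -/
theorem law_growth (h : AdmissibleLaws r φ₁ φ₂) (hlam : φ₁ 1 ≤ φ₂ 1) (hr : 2 ≤ r) :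
    ∃ K : ℝ, 0 < K ∧ ∀ t : ℝ, 0 ≤ t → law φ₁ φ₂ (t ^ 2) ≤ K * (1 + t) ^ (r - 2) := by
  obtain ⟨c, C, hc, hC, hg⟩ := h.growth
  -- The factor 2 arises because both `1` and `a ^ ((r - 2) / 2)` are at most `(1 + t) ^ (r - 2)`.
  refine ⟨2 * C, by positivity, fun t ht => ?_⟩
  have h1 : (1 : ℝ) ≤ (1 + t) ^ (r - 2) := Real.one_le_rpow (by linarith) (by linarith)
  have key : ∀ a : ℝ, 1 ≤ a → a ^ ((r - 2) / 2) ≤ (1 + t) ^ (r - 2) →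
      law φ₁ φ₂ a ≤ 2 * C * (1 + t) ^ (r - 2) := by
    intro a ha hat
    rw [law_of_ge ha]
    nlinarith [(hg a ha).2]
  rcases le_total 1 (t ^ 2) with h2 | h2
  · refine key _ h2 ?_
    rw [← Real.rpow_natCast t 2, ← Real.rpow_mul ht]
    have : ((2 : ℕ) : ℝ) * ((r - 2) / 2) = r - 2 := by push_cast; ring
    rw [this]
    exact Real.rpow_le_rpow ht (by linarith) (by linarith)
  · exact (h.law_mono hlam h2).trans (key 1 le_rfl (by simpa using h1))

end AdmissibleLaws

/-- The primitive of the joined law. -/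
noncomputable def lawPrimitive (φ₁ φ₂ : ℝ → ℝ) (a : ℝ) : ℝ := ∫ t in (1 : ℝ)..a, law φ₁ φ₂ t / 2

/-- Below `1` the two integrands can differ only at the endpoint `t = 1`, a null set. -/
theorem Psi_eq_lawPrimitive {φ₁ φ₂ : ℝ → ℝ} {a : ℝ} (ha : 0 ≤ a) :
    Psi φ₁ φ₂ a = lawPrimitive φ₁ φ₂ a := by
  unfold Psi lawPrimitive primitive
  split_ifs with h1
  · refine intervalIntegral.integral_congr_ae ?_
    have : ∀ᵐ t : ℝ, t ≠ 1 := by simp [ae_iff]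
    filter_upwards [this] with t ht hm
    rw [uIoc_comm, uIoc_of_le h1] at hm
    rw [law_of_lt (ha.trans hm.1.le) (lt_of_le_of_ne hm.2 ht)]
  · refine intervalIntegral.integral_congr fun t ht => ?_
    rw [uIcc_of_le (not_le.1 h1).le] at ht
    simp only [law_of_ge ht.1]

namespace AdmissibleLaws

variable {r : ℝ} {φ₁ φ₂ : ℝ → ℝ}

theorem lawPrimitive_continuous (h : AdmissibleLaws r φ₁ φ₂) (hlam : φ₁ 1 ≤ φ₂ 1) :
    Continuous (lawPrimitive φ₁ φ₂) :=
  intervalIntegral.continuous_primitive (h.law_intervalIntegrable hlam) 1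

theorem lawPrimitive_sub (h : AdmissibleLaws r φ₁ φ₂) (hlam : φ₁ 1 ≤ φ₂ 1) (a b : ℝ) :
    lawPrimitive φ₁ φ₂ b - lawPrimitive φ₁ φ₂ a = ∫ t in a..b, law φ₁ φ₂ t / 2 :=
  intervalIntegral.integral_interval_sub_left (h.law_intervalIntegrable hlam _ _)
    (h.law_intervalIntegrable hlam _ _)

/-- The subgradient inequality. -/
theorem mul_sub_le_lawPrimitive_sub (h : AdmissibleLaws r φ₁ φ₂) (hlam : φ₁ 1 ≤ φ₂ 1) (a b : ℝ) :
    law φ₁ φ₂ a / 2 * (b - a) ≤ lawPrimitive φ₁ φ₂ b - lawPrimitive φ₁ φ₂ a := by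
  have hc : ∀ x y : ℝ, ∫ _ in x..y, law φ₁ φ₂ a / 2 = law φ₁ φ₂ a / 2 * (y - x) := fun x y => by
    rw [intervalIntegral.integral_const, smul_eq_mul, mul_comm]
  rcases le_total a b with hab | hab
  · rw [h.lawPrimitive_sub hlam, ← hc]
    refine intervalIntegral.integral_mono_on hab (by simp) (h.law_intervalIntegrable hlam _ _)
      fun t ht => ?_
    have := h.law_mono hlam ht.1
    linarith
  · have h1 : lawPrimitive φ₁ φ₂ a - lawPrimitive φ₁ φ₂ b ≤ law φ₁ φ₂ a / 2 * (a - b) := by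
      rw [h.lawPrimitive_sub hlam, ← hc]
      refine intervalIntegral.integral_mono_on hab (h.law_intervalIntegrable hlam _ _) (by simp)
        fun t ht => ?_
      have := h.law_mono hlam ht.2
      linarith
    linarith

theorem lawPrimitive_mono (h : AdmissibleLaws r φ₁ φ₂) (hlam : φ₁ 1 ≤ φ₂ 1) :
    Monotone (lawPrimitive φ₁ φ₂) := by
  intro a b hab
  have h1 := h.mul_sub_le_lawPrimitive_sub hlam a b
  have h2 := h.law_nonneg hlam a
  nlinarith

/-- A monotone law has a larger integral over `[a, a+b]` than over `[0, b]`. -/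
theorem lawPrimitive_superadditive (h : AdmissibleLaws r φ₁ φ₂) (hlam : φ₁ 1 ≤ φ₂ 1) {a b : ℝ}
    (ha : 0 ≤ a) (hb : 0 ≤ b) :
    lawPrimitive φ₁ φ₂ a + lawPrimitive φ₁ φ₂ b
      ≤ lawPrimitive φ₁ φ₂ (a + b) + lawPrimitive φ₁ φ₂ 0 := by
  have h1 : ∫ t in (0 : ℝ)..b, law φ₁ φ₂ t / 2 ≤ ∫ t in (0 : ℝ)..b, law φ₁ φ₂ (a + t) / 2 := by
    have hm : Monotone fun t => law φ₁ φ₂ (a + t) := fun x y hxy =>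
      h.law_mono hlam (by linarith)
    refine intervalIntegral.integral_mono_on hb (h.law_intervalIntegrable hlam _ _)
      (hm.intervalIntegrable.div_const 2) fun t _ => ?_
    have := h.law_mono hlam (show t ≤ a + t by linarith)
    linarith
  rw [intervalIntegral.integral_comp_add_left (fun t => law φ₁ φ₂ t / 2), add_zero,
    ← h.lawPrimitive_sub hlam, ← h.lawPrimitive_sub hlam] at h1
  linarith

theorem lawPrimitive_zero_lt (h : AdmissibleLaws r φ₁ φ₂) (hlam : φ₁ 1 ≤ φ₂ 1) {a : ℝ}
    (ha : 0 < a) : lawPrimitive φ₁ φ₂ 0 < lawPrimitive φ₁ φ₂ a := by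
  -- The law may vanish at `0`, so the strict increase comes from the slope at `a / 2`.
  have h1 := h.mul_sub_le_lawPrimitive_sub hlam (a / 2) a
  have h2 := h.lawPrimitive_mono hlam (show (0 : ℝ) ≤ a / 2 by linarith)
  have h3 := h.law_pos hlam (half_pos ha)
  nlinarith

/-- Uniform convexity of `z ↦ Ψ(|z|²)`. -/
theorem lawPrimitive_midpoint (h : AdmissibleLaws r φ₁ φ₂) (hlam : φ₁ 1 ≤ φ₂ 1) {E : Type*}
    [NormedAddCommGroup E] [InnerProductSpace ℝ E] (z w : E) :
    lawPrimitive φ₁ φ₂ (‖(2 : ℝ)⁻¹ • (z + w)‖ ^ 2)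
        + (lawPrimitive φ₁ φ₂ ((‖z - w‖ / 2) ^ 2) - lawPrimitive φ₁ φ₂ 0)
      ≤ (lawPrimitive φ₁ φ₂ (‖z‖ ^ 2) + lawPrimitive φ₁ φ₂ (‖w‖ ^ 2)) / 2 := by
  have hp := parallelogram_law_with_norm ℝ z w
  have hs : ‖(2 : ℝ)⁻¹ • (z + w)‖ ^ 2 + (‖z - w‖ / 2) ^ 2 = (‖z‖ ^ 2 + ‖w‖ ^ 2) / 2 := by
    rw [norm_smul]
    norm_num
    nlinarith
  have h1 := h.lawPrimitive_superadditive hlam (sq_nonneg ‖(2 : ℝ)⁻¹ • (z + w)‖)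
    (sq_nonneg (‖z - w‖ / 2))
  rw [hs] at h1
  -- Both subgradients are taken at the mean of the squares; their linear terms cancel in the sum.
  have h2 := h.mul_sub_le_lawPrimitive_sub hlam ((‖z‖ ^ 2 + ‖w‖ ^ 2) / 2) (‖z‖ ^ 2)
  have h3 := h.mul_sub_le_lawPrimitive_sub hlam ((‖z‖ ^ 2 + ‖w‖ ^ 2) / 2) (‖w‖ ^ 2)
  nlinarith

/-- The vector form of the subgradient inequality. -/
theorem inner_le_lawPrimitive_sub (h : AdmissibleLaws r φ₁ φ₂) (hlam : φ₁ 1 ≤ φ₂ 1) {E : Type*}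
    [NormedAddCommGroup E] [InnerProductSpace ℝ E] (z w : E) :
    inner ℝ (law φ₁ φ₂ (‖z‖ ^ 2) • z) (w - z)
      ≤ lawPrimitive φ₁ φ₂ (‖w‖ ^ 2) - lawPrimitive φ₁ φ₂ (‖z‖ ^ 2) := by
  refine le_trans ?_ (h.mul_sub_le_lawPrimitive_sub hlam _ _)
  have h1 : ‖w‖ ^ 2 - ‖z‖ ^ 2 = 2 * inner ℝ z (w - z) + ‖w - z‖ ^ 2 := by
    have := norm_add_sq_real z (w - z)
    rw [add_sub_cancel] at this
    linarith
  rw [h1, real_inner_smul_left]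
  nlinarith [h.law_nonneg hlam (‖z‖ ^ 2), sq_nonneg ‖w - z‖,
    mul_nonneg (h.law_nonneg hlam (‖z‖ ^ 2)) (sq_nonneg ‖w - z‖)]

/-- The difference quotient is bounded by the slope at the far end. -/
theorem lawPrimitive_sub_le (h : AdmissibleLaws r φ₁ φ₂) (hlam : φ₁ 1 ≤ φ₂ 1) {E : Type*}
    [NormedAddCommGroup E] [InnerProductSpace ℝ E] (z y : E) (t : ℝ) :
    lawPrimitive φ₁ φ₂ (‖z + t • y‖ ^ 2) - lawPrimitive φ₁ φ₂ (‖z‖ ^ 2)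
      ≤ t * (law φ₁ φ₂ (‖z + t • y‖ ^ 2) * inner ℝ (z + t • y) y) := by
  have h1 := h.inner_le_lawPrimitive_sub hlam (z + t • y) z
  have h2 : z - (z + t • y) = (-t) • y := by rw [neg_smul]; abel
  rw [h2, real_inner_smul_left, real_inner_smul_right] at h1
  linarith

theorem lawPrimitive_lower (h : AdmissibleLaws r φ₁ φ₂) (hlam : φ₁ 1 ≤ φ₂ 1) (hr : 2 ≤ r) :
    ∃ c : ℝ, 0 < c ∧ ∀ b : ℝ, 1 ≤ b →
      c * (b ^ (r / 2) - 1) ≤ lawPrimitive φ₁ φ₂ b - lawPrimitive φ₁ φ₂ 1 := by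
  obtain ⟨c, C, hc, hC, hg⟩ := h.growth
  refine ⟨c / r, by positivity, fun b hb => ?_⟩
  have h1 : ∫ t in (1 : ℝ)..b, c / 2 * t ^ ((r - 2) / 2) = c / r * (b ^ (r / 2) - 1) := by
    rw [intervalIntegral.integral_const_mul, integral_rpow (Or.inl (by linarith))]
    have : (r - 2) / 2 + 1 = r / 2 := by ring
    rw [this, Real.one_rpow]
    field_simp
  rw [← h1, h.lawPrimitive_sub hlam]
  refine intervalIntegral.integral_mono_on hb
    ((intervalIntegral.intervalIntegrable_rpow' (by linarith)).const_mul _)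
    (h.law_intervalIntegrable hlam _ _) fun t ht => ?_
  rw [law_of_ge ht.1]
  linarith [(hg t ht.1).1]

/-- No rate of growth is known near `0`, where `φ₁` may vanish. Arguments below `ε` go into the
error term; on `[ε, 1]` the gain is at least its value at `ε`, and beyond `1` the growth bound
applies. Hence the minimum in the constant. -/
theorem rpow_le_lawPrimitive (h : AdmissibleLaws r φ₁ φ₂) (hlam : φ₁ 1 ≤ φ₂ 1) (hr : 2 ≤ r)
    {ε : ℝ} (hε : 0 < ε) (hε1 : ε ≤ 1) :
    ∃ c : ℝ, 0 < c ∧ ∀ b : ℝ, 0 ≤ b →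
      c * b ^ (r / 2) ≤ c * ε ^ (r / 2) + (lawPrimitive φ₁ φ₂ b - lawPrimitive φ₁ φ₂ 0) := by
  obtain ⟨c, hc, hl⟩ := h.lawPrimitive_lower hlam hr
  have hpos := h.lawPrimitive_zero_lt hlam hε
  set k := min (lawPrimitive φ₁ φ₂ ε - lawPrimitive φ₁ φ₂ 0) c with hk
  have hk0 : 0 < k := lt_min (by linarith) hc
  have hk1 : k ≤ lawPrimitive φ₁ φ₂ ε - lawPrimitive φ₁ φ₂ 0 := min_le_left _ _
  have hkc : k ≤ c := min_le_right _ _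
  refine ⟨k, hk0, fun b hb => ?_⟩
  have hmono := h.lawPrimitive_mono hlam
  have he : 0 ≤ k * ε ^ (r / 2) := by positivity
  rcases le_total b ε with h1 | h1
  · have h2 : b ^ (r / 2) ≤ ε ^ (r / 2) := Real.rpow_le_rpow hb h1 (by linarith)
    nlinarith [hmono hb]
  · rcases le_total b 1 with h2 | h2
    · have h3 : b ^ (r / 2) ≤ 1 := Real.rpow_le_one hb h2 (by linarith)
      nlinarith [hmono h1]
    · have h3 : 1 ≤ b ^ (r / 2) := Real.one_le_rpow h2 (by linarith)
      nlinarith [hmono hε1, hl b h2]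

end AdmissibleLaws
end AdaptiveDarcy

/-! ### The direct method and the energy on `L^r`. -/

namespace AdaptiveDarcy

/-- The direct method for functionals whose near-minimizers are close to each other. -/
theorem exists_minimizer_of_near {X : Type*} [NormedAddCommGroup X] [NormedSpace ℝ X]
    [CompleteSpace X] {S : Set X} (hS : IsClosed S) (hne : S.Nonempty)
    (hmid : ∀ u ∈ S, ∀ w ∈ S, (2 : ℝ)⁻¹ • (u + w) ∈ S) {J : X → ℝ}
    (hbdd : ∃ m : ℝ, ∀ u, m ≤ J u)
    (hnear : ∀ ρ : ℝ, 0 < ρ → ∃ δ : ℝ, 0 < δ ∧ ∀ (m : ℝ) (u w : X),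
      m ≤ J ((2 : ℝ)⁻¹ • (u + w)) → J u ≤ m + δ → J w ≤ m + δ → ‖u - w‖ ≤ ρ)
    (hsub : ∀ u, ∃ L : X →L[ℝ] ℝ, ∀ w, J u + L (w - u) ≤ J w) :
    ∃ u ∈ S, ∀ w ∈ S, J u ≤ J w := by
  obtain ⟨m₀, hm₀⟩ := hbdd
  have hB : BddBelow (J '' S) := ⟨m₀, by rintro _ ⟨u, _, rfl⟩; exact hm₀ u⟩
  have hN : (J '' S).Nonempty := hne.image J
  set m := sInf (J '' S) with hm
  have hle : ∀ w ∈ S, m ≤ J w := fun w hw => csInf_le hB ⟨w, hw, rfl⟩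
  have hex : ∀ n : ℕ, ∃ u ∈ S, J u < m + 1 / ((n : ℝ) + 1) := by
    intro n
    obtain ⟨_, ⟨u, hu, rfl⟩, hlt⟩ := exists_lt_of_csInf_lt hN
      (show sInf (J '' S) < m + 1 / ((n : ℝ) + 1) from lt_add_of_pos_right _ (by positivity))
    exact ⟨u, hu, hlt⟩
  choose u huS hu using hex
  -- Midpoints stay in `S` and so have energy at least `m`; hence `hnear` applies to two late terms.
  have hcau : CauchySeq u := by
    refine Metric.cauchySeq_iff'.2 fun ε hε => ?_
    obtain ⟨δ, hδ, hclose⟩ := hnear (ε / 2) (half_pos hε)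
    obtain ⟨N, hN⟩ := exists_nat_one_div_lt hδ
    have hJ : ∀ n ≥ N, J (u n) ≤ m + δ := fun n hn => by
      have h1 := Nat.one_div_le_one_div (α := ℝ) hn
      linarith [hu n]
    refine ⟨N, fun n hn => ?_⟩
    rw [dist_eq_norm]
    have := hclose m (u n) (u N) (hle _ (hmid _ (huS n) _ (huS N))) (hJ n hn) (hJ N le_rfl)
    linarith
  obtain ⟨v, hv⟩ := cauchySeq_tendsto_of_complete hcau
  refine ⟨v, hS.mem_of_tendsto hv (Eventually.of_forall huS), fun w hw => ?_⟩
  refine le_trans ?_ (hle w hw)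
  -- The continuous affine minorant at the limit stands in for lower semicontinuity.
  obtain ⟨L, hL⟩ := hsub v
  have h1 : Tendsto (fun n => J v + L (u n - v)) atTop (𝓝 (J v)) := by
    have : Tendsto (fun n => J v + L (u n - v)) atTop (𝓝 (J v + L (v - v))) :=
      ((L.continuous.tendsto _).comp (hv.sub_const v)).const_add _
    simpa using this
  have h2 : Tendsto (fun n : ℕ => m + 1 / ((n : ℝ) + 1)) atTop (𝓝 m) := by
    simpa using tendsto_one_div_add_atTop_nhds_zero_nat.const_add m
  exact le_of_tendsto_of_tendsto' h1 h2 fun n => (hL _).trans (hu n).le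

theorem holderConjugate_conjExp {r : ℝ} (hr : 2 ≤ r) : r.HolderConjugate (conjExp r) :=
  Real.HolderConjugate.conjExponent (by linarith)

theorem conjExp_le_two {r : ℝ} (hr : 2 ≤ r) : conjExp r ≤ 2 := by
  unfold conjExp
  rw [div_le_iff₀ (by linarith)]
  linarith

section Lp

variable {d : ℕ} {Ω : Set (Space d)} {r : ℝ}

theorem pairing_congr {g g' φ φ' : Space d → Space d} (hg : g =ᵐ[volume.restrict Ω] g')
    (hφ : φ =ᵐ[volume.restrict Ω] φ') : pairing Ω g φ = pairing Ω g' φ' := by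
  refine integral_congr_ae ?_
  filter_upwards [hg, hφ] with x h1 h2
  rw [h1, h2]

/-- The pairing with a field of `L^s` is a continuous linear form on `L^r`. -/
theorem exists_pairing_eq [Fact (1 ≤ ENNReal.ofReal r)] (hr : 2 ≤ r) {g : Space d → Space d}
    (hg : MemLp g (ENNReal.ofReal (conjExp r)) (volume.restrict Ω)) :
    ∃ L : VecLp Ω r →L[ℝ] ℝ, ∀ φ : VecLp Ω r, L φ = pairing Ω g φ := by
  have h1 := holderConjugate_conjExp hr
  have : ENNReal.HolderConjugate (ENNReal.ofReal (conjExp r)) (ENNReal.ofReal r) :=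
    h1.symm.ennrealOfReal
  have : Fact (1 ≤ ENNReal.ofReal (conjExp r)) :=
    ⟨by rw [← ENNReal.ofReal_one]; exact ENNReal.ofReal_le_ofReal h1.symm.lt.le⟩
  refine ⟨(innerSL ℝ).lpPairing (volume.restrict Ω) _ _ hg.toLp, fun φ => ?_⟩
  rw [ContinuousLinearMap.lpPairing_eq_integral]
  exact pairing_congr hg.coeFn_toLp ae_eq_rfl

theorem isClosed_V [Fact (1 ≤ ENNReal.ofReal r)] (Ω Sp : Set (Space d)) (hr : 2 ≤ r) :
    IsClosed (V Ω Sp r hr : Set (VecLp Ω r)) := by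
  have h : (V Ω Sp r hr : Set (VecLp Ω r)) = {φ : VecLp Ω r | ∀ (ψ : Space d → ℝ) (G : Space d → Space d),
      MemW0 Ω Sp (conjExp r) ψ G → pairing Ω G φ = 0} := rfl
  rw [h]
  simp only [ofPred_forall]
  refine isClosed_iInter fun ψ => isClosed_iInter fun G => isClosed_iInter fun hψ => ?_
  obtain ⟨L, hL⟩ := exists_pairing_eq hr hψ.isSobolev.memLp_grad
  simp only [← hL]
  exact isClosed_eq L.continuous continuous_const

theorem norm_rpow_eq_integral (hr : 0 < r) (u : VecLp Ω r) :
    ‖u‖ ^ r = ∫ x in Ω, ‖u x‖ ^ r := by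
  have h0 : 0 ≤ ∫ x in Ω, ‖u x‖ ^ r := integral_nonneg fun x => by positivity
  rw [Lp.norm_def, toReal_eLpNorm (Lp.aestronglyMeasurable u),
    lpNorm_eq_integral_norm_rpow_toReal (by simpa using hr) ENNReal.ofReal_ne_top
      (Lp.aestronglyMeasurable u), ENNReal.toReal_ofReal hr.le, ← Real.rpow_mul h0,
    inv_mul_cancel₀ hr.ne', Real.rpow_one]

variable [IsFiniteMeasure (volume.restrict Ω)]

theorem memLp_one_add_norm {E : Type*} [NormedAddCommGroup E] {u : Space d → E}
    (hu : MemLp u (ENNReal.ofReal r) (volume.restrict Ω)) :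
    MemLp (fun x => 1 + ‖u x‖) (ENNReal.ofReal r) (volume.restrict Ω) :=
  (memLp_const (1 : ℝ)).add hu.norm

theorem integrable_one_add_norm_rpow (hr : 0 ≤ r) {E : Type*} [NormedAddCommGroup E]
    {u : Space d → E}
    (hu : MemLp u (ENNReal.ofReal r) (volume.restrict Ω)) :
    Integrable (fun x => (1 + ‖u x‖) ^ r) (volume.restrict Ω) := by
  have h := (memLp_one_add_norm hu).integrable_norm_rpow'
  rw [ENNReal.toReal_ofReal hr] at h
  refine h.congr (Eventually.of_forall fun x => ?_)
  simp only [Real.norm_of_nonneg (show (0 : ℝ) ≤ 1 + ‖u x‖ by positivity)]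

end Lp

namespace AdmissibleLaws

variable {d : ℕ} {Ω : Set (Space d)} {r : ℝ} {φ₁ φ₂ : ℝ → ℝ}
  [IsFiniteMeasure (volume.restrict Ω)]

/-- The field is bounded by `K (1 + |u|)^(r-1)`, and `s (r - 1) = r`. -/
theorem memLp_law_smul (h : AdmissibleLaws r φ₁ φ₂) (hlam : φ₁ 1 ≤ φ₂ 1) (hr : 2 ≤ r)
    {u : Space d → Space d} (hu : MemLp u (ENNReal.ofReal r) (volume.restrict Ω)) :
    MemLp (fun x => law φ₁ φ₂ (‖u x‖ ^ 2) • u x) (ENNReal.ofReal (conjExp r))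
      (volume.restrict Ω) := by
  obtain ⟨K, hK, hg⟩ := h.law_growth hlam hr
  have h1 := (memLp_one_add_norm hu).norm_rpow_div (ENNReal.ofReal (r - 1))
  rw [← ENNReal.ofReal_div_of_pos (by linarith), ENNReal.toReal_ofReal (by linarith)] at h1
  refine (h1.const_mul K).mono' ?_ (Eventually.of_forall fun x => ?_)
  · exact (((h.law_mono hlam).measurable.comp_aemeasurable
      (hu.1.norm.aemeasurable.pow_const 2)).aestronglyMeasurable).smul hu.1
  · have h0 : 0 < 1 + ‖u x‖ := by positivity
    have h2 : (1 + ‖u x‖) ^ (r - 1) = (1 + ‖u x‖) ^ (r - 2) * (1 + ‖u x‖) := by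
      rw [← Real.rpow_add_one h0.ne']
      ring_nf
    rw [norm_smul, Real.norm_of_nonneg (h.law_nonneg hlam _), Real.norm_of_nonneg h0.le, h2,
      ← mul_assoc]
    exact mul_le_mul (hg _ (norm_nonneg _)) (by linarith) (norm_nonneg _) (by positivity)

theorem integrable_lawPrimitive (h : AdmissibleLaws r φ₁ φ₂) (hlam : φ₁ 1 ≤ φ₂ 1) (hr : 2 ≤ r)
    {u : Space d → Space d} (hu : MemLp u (ENNReal.ofReal r) (volume.restrict Ω)) :
    Integrable (fun x => lawPrimitive φ₁ φ₂ (‖u x‖ ^ 2)) (volume.restrict Ω) := by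
  obtain ⟨K, hK, hg⟩ := h.law_growth hlam hr
  refine (((integrable_one_add_norm_rpow (by linarith) hu).const_mul K).add
    (integrable_const |lawPrimitive φ₁ φ₂ 0|)).mono' ?_ (Eventually.of_forall fun x => ?_)
  · exact (h.lawPrimitive_continuous hlam).comp_aestronglyMeasurable (hu.1.norm.pow 2)
  · have ht := norm_nonneg (u x)
    have h0 : 0 < 1 + ‖u x‖ := by positivity
    have h1 := h.lawPrimitive_mono hlam (sq_nonneg ‖u x‖)
    -- The primitive vanishes at `1`, so the subgradient at `|u|²` bounds it above by `law(|u|²)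
    -- (|u|² - 1) / 2`.
    have h2 := h.mul_sub_le_lawPrimitive_sub hlam (‖u x‖ ^ 2) 1
    have h3 : lawPrimitive φ₁ φ₂ 1 = 0 := intervalIntegral.integral_same
    have h4 : (1 + ‖u x‖) ^ r = (1 + ‖u x‖) ^ (r - 2) * (1 + ‖u x‖) ^ 2 := by
      rw [← Real.rpow_natCast, ← Real.rpow_add h0]
      norm_num
    have h5 : law φ₁ φ₂ (‖u x‖ ^ 2) * ‖u x‖ ^ 2 ≤ K * (1 + ‖u x‖) ^ r := by
      rw [h4, ← mul_assoc]
      exact mul_le_mul (hg _ ht) (by gcongr; linarith) (by positivity) (by positivity)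
    have h6 := h.law_nonneg hlam (‖u x‖ ^ 2)
    have h7 : 0 ≤ law φ₁ φ₂ (‖u x‖ ^ 2) * ‖u x‖ ^ 2 := by positivity
    rw [Pi.add_apply, Real.norm_eq_abs, abs_le]
    constructor
    · have := neg_abs_le (lawPrimitive φ₁ φ₂ 0)
      linarith
    · have := abs_nonneg (lawPrimitive φ₁ φ₂ 0)
      linarith

end AdmissibleLaws

/-- The energy as a functional of the total velocity. -/
noncomputable def totalEnergy {d : ℕ} {Ω : Set (Space d)} {r : ℝ} (φ₁ φ₂ : ℝ → ℝ)
    (f₀ : VecLp Ω (conjExp r)) (u : VecLp Ω r) : ℝ :=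
  (∫ x in Ω, lawPrimitive φ₁ φ₂ (‖u x‖ ^ 2)) - pairing Ω f₀ u

theorem energy_eq_totalEnergy {d : ℕ} {Ω : Set (Space d)} {r : ℝ} {W : Submodule ℝ (VecLp Ω r)}
    (φ₁ φ₂ : ℝ → ℝ) (f₀ : VecLp Ω (conjExp r)) (uhat : VecLp Ω r) (v : W) :
    energy φ₁ φ₂ f₀ uhat v = totalEnergy φ₁ φ₂ f₀ ((v : VecLp Ω r) + uhat) := by
  unfold energy dissipation totalEnergy
  congr 1
  exact integral_congr_ae (Eventually.of_forall fun x => Psi_eq_lawPrimitive (sq_nonneg _))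

namespace AdmissibleLaws

variable {d : ℕ} {Ω : Set (Space d)} {r : ℝ} {φ₁ φ₂ : ℝ → ℝ}
  [IsFiniteMeasure (volume.restrict Ω)]

theorem exists_le_totalEnergy (h : AdmissibleLaws r φ₁ φ₂) (hlam : φ₁ 1 ≤ φ₂ 1) (hr : 2 ≤ r)
    (f₀ : VecLp Ω (conjExp r)) : ∃ m : ℝ, ∀ u : VecLp Ω r, m ≤ totalEnergy φ₁ φ₂ f₀ u := by
  obtain ⟨c, hc, hl⟩ := h.rpow_le_lawPrimitive hlam hr one_pos le_rfl
  have hconj := holderConjugate_conjExp hr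
  -- With this scaling, Young's inequality yields `c |u|^r / r`, which coercivity absorbs.
  set κ := c ^ r⁻¹ with hκ
  have hκ0 : 0 < κ := by positivity
  have hκr : κ ^ r = c := by
    rw [hκ, ← Real.rpow_mul hc.le, inv_mul_cancel₀ (by linarith), Real.rpow_one]
  have hf : Integrable (fun x => ‖f₀ x‖ ^ conjExp r) (volume.restrict Ω) := by
    have := (Lp.memLp f₀).integrable_norm_rpow'
    rwa [ENNReal.toReal_ofReal hconj.symm.nonneg] at this
  refine ⟨∫ x in Ω, (lawPrimitive φ₁ φ₂ 0 - c - ‖f₀ x‖ ^ conjExp r / κ ^ conjExp r), fun u => ?_⟩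
  have hu := Lp.memLp u
  unfold totalEnergy pairing
  rw [← integral_sub (h.integrable_lawPrimitive hlam hr hu)
    (integrable_inner_of_conj Ω hr (Lp.memLp f₀) hu)]
  refine integral_mono ((integrable_const _).sub (hf.div_const _))
    ((h.integrable_lawPrimitive hlam hr hu).sub
      (integrable_inner_of_conj Ω hr (Lp.memLp f₀) hu)) fun x => ?_
  have h1 := hl (‖u x‖ ^ 2) (sq_nonneg _)
  have h2 : (‖u x‖ ^ 2) ^ (r / 2) = ‖u x‖ ^ r := by
    rw [← Real.rpow_natCast, ← Real.rpow_mul (norm_nonneg _)]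
    congr 1
    push_cast
    ring
  rw [h2, Real.one_rpow, mul_one] at h1
  have h3 := real_inner_le_norm (f₀ x) (u x)
  have h4 := Real.young_inequality_of_nonneg (show 0 ≤ κ * ‖u x‖ by positivity)
    (show 0 ≤ ‖f₀ x‖ / κ by positivity) hconj
  rw [Real.mul_rpow hκ0.le (norm_nonneg _), Real.div_rpow (norm_nonneg _) hκ0.le, hκr] at h4
  have h5 : κ * ‖u x‖ * (‖f₀ x‖ / κ) = ‖f₀ x‖ * ‖u x‖ := by field_simp
  have h6 : c * ‖u x‖ ^ r / r ≤ c * ‖u x‖ ^ r := div_le_self (by positivity) (by linarith)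
  have h7 : ‖f₀ x‖ ^ conjExp r / κ ^ conjExp r / conjExp r ≤ ‖f₀ x‖ ^ conjExp r / κ ^ conjExp r :=
    div_le_self (by positivity) hconj.symm.lt.le
  dsimp only
  linarith

/-- The integrated midpoint inequality; the linear term is affine and cancels. Half of `c (ρ/2)^r`
pays for the error from `ε`, the other half is `δ`. The number `m` is arbitrary, so the estimate
serves existence and uniqueness alike. -/
theorem totalEnergy_near (h : AdmissibleLaws r φ₁ φ₂) (hlam : φ₁ 1 ≤ φ₂ 1) (hr : 2 ≤ r)
    (f₀ : VecLp Ω (conjExp r)) {ρ : ℝ} (hρ : 0 < ρ) :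
    ∃ δ : ℝ, 0 < δ ∧ ∀ (m : ℝ) (u w : VecLp Ω r),
      m ≤ totalEnergy φ₁ φ₂ f₀ ((2 : ℝ)⁻¹ • (u + w)) → totalEnergy φ₁ φ₂ f₀ u ≤ m + δ →
      totalEnergy φ₁ φ₂ f₀ w ≤ m + δ → ‖u - w‖ ≤ ρ := by
  have hr0 : 0 < r := by linarith
  set M := (volume.restrict Ω).real univ with hM
  have hM0 : 0 ≤ M := measureReal_nonneg
  obtain ⟨ε, hε, hε1, hεM⟩ : ∃ ε : ℝ, 0 < ε ∧ ε ≤ 1 ∧ ε ^ (r / 2) * M ≤ (ρ / 2) ^ r / 2 := by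
    set A := (ρ / 2) ^ r / 2 / (M + 1) with hA
    have hA0 : 0 < A := by positivity
    refine ⟨min 1 (A ^ (2 / r)), lt_min one_pos (by positivity), min_le_left _ _, ?_⟩
    have h1 : (min 1 (A ^ (2 / r))) ^ (r / 2) ≤ A := by
      refine (Real.rpow_le_rpow (by positivity) (min_le_right _ _) (by linarith)).trans ?_
      rw [← Real.rpow_mul hA0.le]
      have : 2 / r * (r / 2) = 1 := by field_simp
      rw [this, Real.rpow_one]
    calc _ ≤ A * (M + 1) := mul_le_mul h1 (by linarith) hM0 hA0.le
      _ = _ := div_mul_cancel₀ _ (by positivity)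
  obtain ⟨c, hc, hl⟩ := h.rpow_le_lawPrimitive hlam hr hε hε1
  refine ⟨c * ((ρ / 2) ^ r / 2), by positivity, fun m u w hm hu hw => ?_⟩
  have iL : ∀ y : VecLp Ω r, Integrable (fun x => lawPrimitive φ₁ φ₂ (‖y x‖ ^ 2))
    (volume.restrict Ω) := fun y => h.integrable_lawPrimitive hlam hr (Lp.memLp y)
  have iP : ∀ y : VecLp Ω r, Integrable (fun x => (inner ℝ (f₀ x) (y x) : ℝ))
    (volume.restrict Ω) := fun y => integrable_inner_of_conj Ω hr (Lp.memLp f₀) (Lp.memLp y)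
  have iJ : ∀ y : VecLp Ω r, Integrable
      (fun x => lawPrimitive φ₁ φ₂ (‖y x‖ ^ 2) - (inner ℝ (f₀ x) (y x) : ℝ))
      (volume.restrict Ω) := fun y => (iL y).sub (iP y)
  have hJ : ∀ y : VecLp Ω r, totalEnergy φ₁ φ₂ f₀ y
      = ∫ x in Ω, (lawPrimitive φ₁ φ₂ (‖y x‖ ^ 2) - inner ℝ (f₀ x) (y x)) := fun y =>
    (integral_sub (iL y) (iP y)).symm
  have iN : Integrable (fun x => ‖(u - w) x‖ ^ r) (volume.restrict Ω) := by
    have := (Lp.memLp (u - w)).integrable_norm_rpow'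
    rwa [ENNReal.toReal_ofReal hr0.le] at this
  have iD : Integrable (fun x => c / 2 ^ r * ‖(u - w) x‖ ^ r - c * ε ^ (r / 2))
      (volume.restrict Ω) := (iN.const_mul _).sub (integrable_const _)
  have key : ∫ x in Ω, (c / 2 ^ r * ‖(u - w) x‖ ^ r - c * ε ^ (r / 2)
        + (lawPrimitive φ₁ φ₂ (‖((2 : ℝ)⁻¹ • (u + w) : VecLp Ω r) x‖ ^ 2)
          - inner ℝ (f₀ x) (((2 : ℝ)⁻¹ • (u + w) : VecLp Ω r) x)))
      ≤ ∫ x in Ω, ((lawPrimitive φ₁ φ₂ (‖u x‖ ^ 2) - inner ℝ (f₀ x) (u x))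
        + (lawPrimitive φ₁ φ₂ (‖w x‖ ^ 2) - inner ℝ (f₀ x) (w x))) / 2 := by
    refine integral_mono_ae (iD.add (iJ _))
      (((iJ u).add (iJ w)).div_const 2) ?_
    filter_upwards [Lp.coeFn_sub u w, Lp.coeFn_smul (2 : ℝ)⁻¹ (u + w), Lp.coeFn_add u w]
      with x h1 h2 h3
    rw [h1, h2, Pi.smul_apply, h3, Pi.add_apply, Pi.sub_apply]
    have h4 := h.lawPrimitive_midpoint hlam (u x) (w x)
    have h5 := hl ((‖u x - w x‖ / 2) ^ 2) (sq_nonneg _)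
    have h6 : ((‖u x - w x‖ / 2) ^ 2) ^ (r / 2) = ‖u x - w x‖ ^ r / 2 ^ r := by
      rw [← Real.rpow_natCast, ← Real.rpow_mul (by positivity),
        ← Real.div_rpow (norm_nonneg _) (by norm_num)]
      congr 1
      push_cast
      ring
    have h7 : inner ℝ (f₀ x) ((2 : ℝ)⁻¹ • (u x + w x))
        = (inner ℝ (f₀ x) (u x) + inner ℝ (f₀ x) (w x)) / 2 := by
      rw [real_inner_smul_right, inner_add_right]
      ring
    rw [h6] at h5
    rw [h7]
    have h8 : c / 2 ^ r * ‖u x - w x‖ ^ r = c * (‖u x - w x‖ ^ r / 2 ^ r) := by ring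
    rw [h8]
    linarith
  rw [integral_add iD (iJ _),
    integral_sub (iN.const_mul _) (integrable_const _), integral_const_mul, integral_const,
    integral_div, integral_add (iJ u) (iJ w), ← hJ, ← hJ, ← hJ, ← norm_rpow_eq_integral hr0,
    ← hM, smul_eq_mul] at key
  have h1 : c / 2 ^ r * ‖u - w‖ ^ r ≤ c * (ρ / 2) ^ r := by
    have : c * (ε ^ (r / 2) * M) ≤ c * ((ρ / 2) ^ r / 2) := by gcongr
    linarith
  have h2 : ‖u - w‖ ^ r ≤ ρ ^ r := by
    rw [Real.div_rpow hρ.le (by norm_num), div_mul_eq_mul_div, ← mul_div_assoc,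
      div_le_div_iff_of_pos_right (by positivity)] at h1
    exact le_of_mul_le_mul_left h1 hc
  exact (Real.rpow_le_rpow_iff (show 0 ≤ ‖u - w‖ from ENNReal.toReal_nonneg) hρ.le hr0).1 h2

theorem totalEnergy_subgradient [Fact (1 ≤ ENNReal.ofReal r)] (h : AdmissibleLaws r φ₁ φ₂)
    (hlam : φ₁ 1 ≤ φ₂ 1) (hr : 2 ≤ r) (f₀ : VecLp Ω (conjExp r)) (u : VecLp Ω r) :
    ∃ L : VecLp Ω r →L[ℝ] ℝ, ∀ w : VecLp Ω r,
      totalEnergy φ₁ φ₂ f₀ u + L (w - u) ≤ totalEnergy φ₁ φ₂ f₀ w := by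
  have hg := h.memLp_law_smul hlam hr (Lp.memLp u)
  obtain ⟨L₁, hL₁⟩ := exists_pairing_eq (Ω := Ω) hr hg
  obtain ⟨L₀, hL₀⟩ := exists_pairing_eq (Ω := Ω) hr (Lp.memLp f₀)
  refine ⟨L₁ - L₀, fun w => ?_⟩
  have iu := h.integrable_lawPrimitive hlam hr (Lp.memLp u)
  have iw := h.integrable_lawPrimitive hlam hr (Lp.memLp w)
  have h1 : L₁ (w - u) ≤ (∫ x in Ω, lawPrimitive φ₁ φ₂ (‖w x‖ ^ 2))
      - ∫ x in Ω, lawPrimitive φ₁ φ₂ (‖u x‖ ^ 2) := by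
    rw [hL₁, ← integral_sub iw iu]
    refine integral_mono_ae (integrable_inner_of_conj Ω hr hg (Lp.memLp (w - u)))
      (iw.sub iu) ?_
    filter_upwards [Lp.coeFn_sub w u] with x hx
    rw [hx]
    exact h.inner_le_lawPrimitive_sub hlam _ _
  rw [sub_apply, map_sub L₀]
  unfold totalEnergy
  rw [← hL₀, ← hL₀]
  linarith

/-- Convexity of the energy along segments, for the comparison of local and global minima. -/
theorem totalEnergy_segment_le (h : AdmissibleLaws r φ₁ φ₂) (hlam : φ₁ 1 ≤ φ₂ 1) (hr : 2 ≤ r)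
    (f₀ : VecLp Ω (conjExp r)) (u w : VecLp Ω r) {t : ℝ} (ht0 : 0 ≤ t) (ht1 : t ≤ 1) :
    totalEnergy φ₁ φ₂ f₀ (u + t • (w - u))
      ≤ (1 - t) * totalEnergy φ₁ φ₂ f₀ u + t * totalEnergy φ₁ φ₂ f₀ w := by
  have : Fact (1 ≤ ENNReal.ofReal r) :=
    ⟨by rw [← ENNReal.ofReal_one]; exact ENNReal.ofReal_le_ofReal (by linarith)⟩
  -- One subgradient at the intermediate point is tested at both ends; with weights `1 - t` and `t`
  -- the linear parts cancel.
  obtain ⟨L, hL⟩ := h.totalEnergy_subgradient hlam hr f₀ (u + t • (w - u))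
  have h1 := hL u
  have h2 := hL w
  have e1 : u - (u + t • (w - u)) = (-t) • (w - u) := by rw [neg_smul]; abel
  have e2 : w - (u + t • (w - u)) = (1 - t) • (w - u) := by rw [sub_smul, one_smul]; abel
  rw [e1, map_smul, smul_eq_mul] at h1
  rw [e2, map_smul, smul_eq_mul] at h2
  nlinarith [mul_le_mul_of_nonneg_left h1 (sub_nonneg.2 ht1), mul_le_mul_of_nonneg_left h2 ht0]

end AdmissibleLaws
end AdaptiveDarcy

/-! ### The Euler-Lagrange equation and the interface multiplier. -/

namespace AdaptiveDarcy

/-- A linear form that is dominated by the norm of a linear map into a Hilbert space factors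
through this map. -/
theorem exists_inner_eq_of_abs_le {W H : Type*} [AddCommGroup W] [Module ℝ W]
    [NormedAddCommGroup H] [InnerProductSpace ℝ H] [CompleteSpace H] (T : W →ₗ[ℝ] H)
    (L : W →ₗ[ℝ] ℝ) {C : ℝ} (hC : ∀ φ, |L φ| ≤ C * ‖T φ‖) :
    ∃ h : H, ∀ φ, L φ = inner ℝ h (T φ) := by
  have hker : LinearMap.ker T ≤ LinearMap.ker L := fun φ hφ => by
    have h1 := hC φ
    rw [LinearMap.mem_ker.1 hφ, norm_zero, mul_zero] at h1
    exact LinearMap.mem_ker.2 (abs_nonpos_iff.1 h1)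
  set l : LinearMap.range T →ₗ[ℝ] ℝ :=
    ((LinearMap.ker T).liftQ L hker).comp T.quotKerEquivRange.symm.toLinearMap
  have hl : ∀ φ, l ⟨T φ, LinearMap.mem_range_self T φ⟩ = L φ := fun φ => by
    have h1 : T.quotKerEquivRange.symm ⟨T φ, LinearMap.mem_range_self T φ⟩
        = (LinearMap.ker T).mkQ φ := by
      rw [LinearEquiv.symm_apply_eq]
      rfl
    simp only [l, LinearMap.comp_apply, LinearEquiv.coe_coe, h1]
    rfl
  have hb : ∀ y : LinearMap.range T, ‖l y‖ ≤ C * ‖y‖ := by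
    rintro ⟨_, φ, rfl⟩
    rw [hl φ]
    exact hC φ
  -- The range of `T` need not be closed, so Hahn-Banach precedes Riesz.
  obtain ⟨g, hg, -⟩ := exists_extension_norm_eq (LinearMap.range T) (l.mkContinuous C hb)
  refine ⟨(InnerProductSpace.toDual ℝ H).symm g, fun φ => ?_⟩
  rw [InnerProductSpace.toDual_symm_apply, ← hl φ]
  exact (hg ⟨T φ, LinearMap.mem_range_self T φ⟩).symm

section Lp

variable {d : ℕ} {Ω : Set (Space d)} {r : ℝ}

theorem measurableSet_norm_eq_one {p : ℝ≥0∞} (u : Lp (Space d) p (volume.restrict Ω)) :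
    MeasurableSet {x | ‖u x‖ = 1} :=
  (Lp.stronglyMeasurable u).norm.measurable (measurableSet_singleton 1)

variable [IsFiniteMeasure (volume.restrict Ω)]

theorem memLp_two (hr : 2 ≤ r) (φ : VecLp Ω r) : MemLp φ 2 (volume.restrict Ω) :=
  (Lp.memLp φ).mono_exponent (by simpa using ENNReal.ofReal_le_ofReal hr)

/-- The restriction of `L^r` fields to a measurable set, as a map into `L²`. -/
noncomputable def restrictL2 (hr : 2 ≤ r) {s : Set (Space d)} (hs : MeasurableSet s) :
    VecLp Ω r →ₗ[ℝ] Lp (Space d) 2 (volume.restrict Ω) where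
  toFun φ := ((memLp_two hr φ).indicator hs).toLp
  map_add' φ φ' := by
    rw [← MemLp.toLp_add]
    refine MemLp.toLp_congr _ _ ?_
    filter_upwards [Lp.coeFn_add φ φ'] with x hx
    by_cases h : x ∈ s
    · simp only [Pi.add_apply, indicator_of_mem h]
      exact hx
    · simp [h]
  map_smul' c φ := by
    rw [RingHom.id_apply, ← MemLp.toLp_const_smul]
    refine MemLp.toLp_congr _ _ ?_
    filter_upwards [Lp.coeFn_smul c φ] with x hx
    by_cases h : x ∈ s
    · simp only [Pi.smul_apply, indicator_of_mem h]
      exact hx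
    · simp [h]

theorem coeFn_restrictL2 (hr : 2 ≤ r) {s : Set (Space d)} (hs : MeasurableSet s) (φ : VecLp Ω r) :
    restrictL2 hr hs φ =ᵐ[volume.restrict Ω] s.indicator φ := by
  have h : restrictL2 hr hs φ = ((memLp_two hr φ).indicator hs).toLp := rfl
  rw [h]
  exact MemLp.coeFn_toLp _

/-- Hölder on a finite measure space. It turns the `L¹` interface term into an `L²` bound, so that
the multiplier can be found in a Hilbert space. -/
theorem exists_integral_norm_le (Ω : Set (Space d)) [IsFiniteMeasure (volume.restrict Ω)] :
    ∃ C : ℝ, 0 ≤ C ∧ ∀ g : Lp (Space d) 2 (volume.restrict Ω), ∫ x in Ω, ‖g x‖ ≤ C * ‖g‖ := by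
  have hfin : (volume.restrict Ω) univ ^ (1 / (1 : ℝ≥0∞).toReal - 1 / (2 : ℝ≥0∞).toReal) ≠ ⊤ :=
    ENNReal.rpow_ne_top_of_nonneg (by norm_num) (measure_ne_top _ _)
  refine ⟨((volume.restrict Ω) univ ^
    (1 / (1 : ℝ≥0∞).toReal - 1 / (2 : ℝ≥0∞).toReal)).toReal, ENNReal.toReal_nonneg, fun g => ?_⟩
  have h1 := eLpNorm_le_eLpNorm_mul_rpow_measure_univ (μ := volume.restrict Ω) (f := g)
    (p := 1) (q := 2) (by norm_num) (Lp.aestronglyMeasurable g)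
  have h2 := ENNReal.toReal_mono (ENNReal.mul_ne_top (Lp.eLpNorm_ne_top g) hfin) h1
  rw [ENNReal.toReal_mul, toReal_eLpNorm (Lp.aestronglyMeasurable g),
    lpNorm_one_eq_integral_norm (Lp.aestronglyMeasurable g), mul_comm] at h2
  exact h2

end Lp

section EulerLagrange

variable {d : ℕ} {Ω : Set (Space d)} {r : ℝ} {φ₁ φ₂ : ℝ → ℝ}

theorem bulkLaw_eq_indicator (φ₁ φ₂ : ℝ → ℝ) (u : Space d → Space d) :
    bulkLaw φ₁ φ₂ u = {x | ‖u x‖ = 1}ᶜ.indicator fun x => law φ₁ φ₂ (‖u x‖ ^ 2) • u x := by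
  funext x
  unfold bulkLaw
  rcases lt_trichotomy ‖u x‖ 1 with h1 | h1 | h1
  · have h2 : ‖u x‖ ^ 2 < 1 := by nlinarith [norm_nonneg (u x)]
    simp [indicator, h1, h1.ne, h1.not_gt, law_of_lt (sq_nonneg ‖u x‖) h2]
  · simp [indicator, h1]
  · have h2 : 1 ≤ ‖u x‖ ^ 2 := by nlinarith
    simp [indicator, h1, h1.ne', h1.not_gt, law_of_ge h2]

namespace AdmissibleLaws

/-- An upper bound for the slope of the energy density at `z + t y` in the direction `y`. -/
noncomputable def slopeBound (φ₁ φ₂ : ℝ → ℝ) (z y : Space d) (t : ℝ) : ℝ :=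
  if ‖z‖ = 1 then law φ₁ φ₂ ((1 + t * ‖y‖) ^ 2) * ((1 + t * ‖y‖) * ‖y‖)
  else law φ₁ φ₂ (‖z + t • y‖ ^ 2) * inner ℝ (z + t • y) y

/-- If `|z| = 1`, then `z + t y` may lie on either side of the jump and the true slope is hard to
follow. The bound uses the radius `1 + t |y| ≥ 1` instead, where the law is continuous. -/
theorem tendsto_slopeBound (h : AdmissibleLaws r φ₁ φ₂) (z y : Space d) :
    Tendsto (slopeBound φ₁ φ₂ z y) (𝓝[≥] 0) (𝓝 (slopeBound φ₁ φ₂ z y 0)) := by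
  unfold slopeBound
  split_ifs with hz
  · have h1 : ContinuousOn (fun t : ℝ => law φ₁ φ₂ ((1 + t * ‖y‖) ^ 2)) (Ici 0) :=
      h.law_continuousOn.comp (by fun_prop) fun t ht =>
        one_le_pow₀ (le_add_of_nonneg_right (mul_nonneg (mem_Ici.1 ht) (norm_nonneg y)))
    have h2 : ContinuousOn (fun t : ℝ => (1 + t * ‖y‖) * ‖y‖) (Ici 0) := by fun_prop
    exact (h1.mul h2) 0 self_mem_Ici
  · have h1 : ContinuousAt (law φ₁ φ₂) (‖z + (0 : ℝ) • y‖ ^ 2) := by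
      refine h.law_continuousAt ?_
      rw [zero_smul, add_zero]
      exact fun h2 => hz ((pow_eq_one_iff_of_nonneg (norm_nonneg _) two_ne_zero).1 h2)
    have h2 : ContinuousAt (fun t : ℝ => ‖z + t • y‖ ^ 2) 0 := by fun_prop
    have h3 : ContinuousAt (fun t : ℝ => inner ℝ (z + t • y) y) 0 := by fun_prop
    exact ((ContinuousAt.comp (f := fun t : ℝ => ‖z + t • y‖ ^ 2) h1 h2).mul
      h3).continuousWithinAt

theorem slope_le_slopeBound (h : AdmissibleLaws r φ₁ φ₂) (hlam : φ₁ 1 ≤ φ₂ 1) (z y : Space d)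
    {t : ℝ} (ht : 0 ≤ t) :
    lawPrimitive φ₁ φ₂ (‖z + t • y‖ ^ 2) - lawPrimitive φ₁ φ₂ (‖z‖ ^ 2)
      ≤ t * slopeBound φ₁ φ₂ z y t := by
  refine (h.lawPrimitive_sub_le hlam z y t).trans (mul_le_mul_of_nonneg_left ?_ ht)
  unfold slopeBound
  split_ifs with hz
  · have h1 : ‖z + t • y‖ ≤ 1 + t * ‖y‖ := by
      have := norm_add_le z (t • y)
      rwa [hz, norm_smul, Real.norm_of_nonneg ht] at this
    have h2 := (real_inner_le_norm (z + t • y) y).trans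
      (mul_le_mul_of_nonneg_right h1 (norm_nonneg y))
    have h3 : law φ₁ φ₂ (‖z + t • y‖ ^ 2) ≤ law φ₁ φ₂ ((1 + t * ‖y‖) ^ 2) :=
      h.law_mono hlam (pow_le_pow_left₀ (norm_nonneg _) h1 2)
    have h4 : 0 ≤ (1 + t * ‖y‖) * ‖y‖ := by positivity
    exact (mul_le_mul_of_nonneg_left h2 (h.law_nonneg hlam _)).trans
      (mul_le_mul_of_nonneg_right h3 h4)
  · exact le_rfl

theorem abs_slopeBound_le (h : AdmissibleLaws r φ₁ φ₂) (hlam : φ₁ 1 ≤ φ₂ 1) {K : ℝ} (hK : 0 < K)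
    (hg : ∀ t : ℝ, 0 ≤ t → law φ₁ φ₂ (t ^ 2) ≤ K * (1 + t) ^ (r - 2)) (z y : Space d) {t : ℝ}
    (ht : 0 ≤ t) (ht1 : t ≤ 1) :
    |slopeBound φ₁ φ₂ z y t| ≤ K * (1 + (‖z‖ + ‖y‖)) ^ r := by
  set R := ‖z‖ + ‖y‖ with hR
  have hz0 := norm_nonneg z
  have hy0 := norm_nonneg y
  have hty : t * ‖y‖ ≤ ‖y‖ := mul_le_of_le_one_left hy0 ht1
  have key : ∀ ρ : ℝ, 0 ≤ ρ → ρ ≤ R →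
      law φ₁ φ₂ (ρ ^ 2) * (ρ * ‖y‖) ≤ K * (1 + R) ^ r := by
    intro ρ h0 h1
    have h2 : law φ₁ φ₂ (ρ ^ 2) ≤ K * (1 + R) ^ (r - 2) :=
      (h.law_mono hlam (pow_le_pow_left₀ h0 h1 2)).trans (hg R (by positivity))
    have h3 : (1 + R) ^ r = (1 + R) ^ (r - 2) * (1 + R) ^ 2 := by
      rw [← Real.rpow_natCast, ← Real.rpow_add (by positivity)]
      norm_num
    rw [h3, ← mul_assoc K, sq (1 + R)]
    exact mul_le_mul h2 (mul_le_mul (by linarith) (by linarith) hy0 (by positivity))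
      (by positivity) (by positivity)
  unfold slopeBound
  split_ifs with hz
  · rw [abs_of_nonneg (mul_nonneg (h.law_nonneg hlam _) (by positivity))]
    exact key _ (by positivity) (by rw [hR, hz]; linarith)
  · rw [abs_mul, abs_of_nonneg (h.law_nonneg hlam _)]
    refine (mul_le_mul_of_nonneg_left (abs_real_inner_le_norm _ _) (h.law_nonneg hlam _)).trans
      (key _ (norm_nonneg _) ?_)
    have := norm_add_le z (t • y)
    rw [norm_smul, Real.norm_of_nonneg ht] at this
    linarith

theorem aestronglyMeasurable_slopeBound (h : AdmissibleLaws r φ₁ φ₂) (hlam : φ₁ 1 ≤ φ₂ 1)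
    (u φ : VecLp Ω r) (t : ℝ) :
    AEStronglyMeasurable (fun x => slopeBound φ₁ φ₂ (u x) (φ x) t) (volume.restrict Ω) := by
  have hu := (Lp.stronglyMeasurable u).measurable
  have hφ := (Lp.stronglyMeasurable φ).measurable
  have hl := (h.law_mono hlam).measurable
  refine Measurable.aestronglyMeasurable (Measurable.ite (measurableSet_norm_eq_one u) ?_ ?_)
  · exact (hl.comp (by fun_prop)).mul (by fun_prop)
  · exact (hl.comp (by fun_prop)).mul (by fun_prop)

variable [IsFiniteMeasure (volume.restrict Ω)]

theorem memLp_bulkLaw (h : AdmissibleLaws r φ₁ φ₂) (hlam : φ₁ 1 ≤ φ₂ 1) (hr : 2 ≤ r)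
    (u : VecLp Ω r) :
    MemLp (bulkLaw φ₁ φ₂ u) (ENNReal.ofReal (conjExp r)) (volume.restrict Ω) := by
  rw [bulkLaw_eq_indicator]
  exact (h.memLp_law_smul hlam hr (Lp.memLp u)).indicator (measurableSet_norm_eq_one u).compl

/-- The first order condition at a minimizer, in one direction. -/
theorem pairing_le_integral_slopeBound (h : AdmissibleLaws r φ₁ φ₂) (hlam : φ₁ 1 ≤ φ₂ 1)
    (hr : 2 ≤ r) (f₀ : VecLp Ω (conjExp r)) (u φ : VecLp Ω r)
    (hmin : ∀ t : ℝ, 0 < t → totalEnergy φ₁ φ₂ f₀ u ≤ totalEnergy φ₁ φ₂ f₀ (u + t • φ)) :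
    pairing Ω f₀ φ ≤ ∫ x in Ω, slopeBound φ₁ φ₂ (u x) (φ x) 0 := by
  obtain ⟨K, hK, hg⟩ := h.law_growth hlam hr
  have hdom : Integrable (fun x => K * (1 + (‖u x‖ + ‖φ x‖)) ^ r) (volume.restrict Ω) := by
    have h1 := integrable_one_add_norm_rpow (by linarith)
      ((Lp.memLp u).norm.add (Lp.memLp φ).norm)
    refine (h1.congr (Eventually.of_forall fun x => ?_)).const_mul K
    simp only [Pi.add_apply]
    rw [Real.norm_of_nonneg (by positivity)]
  set τ : ℕ → ℝ := fun n => 1 / ((n : ℝ) + 1) with hτ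
  have hτ0 : ∀ n, 0 < τ n := fun n => by positivity
  have hτ1 : ∀ n, τ n ≤ 1 := fun n => by
    rw [hτ]
    exact (div_le_one (by positivity)).2 (by linarith [Nat.cast_nonneg (α := ℝ) n])
  have hτlim : Tendsto τ atTop (𝓝[≥] 0) := tendsto_nhdsWithin_iff.2
    ⟨tendsto_one_div_add_atTop_nhds_zero_nat, Eventually.of_forall fun n => (hτ0 n).le⟩
  have hbound : ∀ n, ∀ᵐ x ∂(volume.restrict Ω),
      ‖slopeBound φ₁ φ₂ (u x) (φ x) (τ n)‖ ≤ K * (1 + (‖u x‖ + ‖φ x‖)) ^ r := fun n =>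
    Eventually.of_forall fun x => h.abs_slopeBound_le hlam hK hg _ _ (hτ0 n).le (hτ1 n)
  -- The dominating function does not depend on `t ∈ [0, 1]`, so the bounds on the difference
  -- quotients pass to the limit `t ↓ 0`.
  have hlim := tendsto_integral_of_dominated_convergence _
    (fun n => h.aestronglyMeasurable_slopeBound hlam u φ (τ n)) hdom hbound
    (Eventually.of_forall fun x => (h.tendsto_slopeBound (u x) (φ x)).comp hτlim)
  refine ge_of_tendsto' hlim fun n => ?_
  have iu := h.integrable_lawPrimitive hlam hr (Lp.memLp u)
  have iw := h.integrable_lawPrimitive hlam hr (Lp.memLp (u + τ n • φ))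
  have iS : Integrable (fun x => slopeBound φ₁ φ₂ (u x) (φ x) (τ n)) (volume.restrict Ω) :=
    hdom.mono' (h.aestronglyMeasurable_slopeBound hlam u φ (τ n)) (hbound n)
  have hae : ∀ᵐ x ∂(volume.restrict Ω), (u + τ n • φ : VecLp Ω r) x = u x + τ n • φ x := by
    filter_upwards [Lp.coeFn_add u (τ n • φ), Lp.coeFn_smul (τ n) φ] with x h1 h2
    rw [h1, Pi.add_apply, h2, Pi.smul_apply]
  have h1 : (∫ x in Ω, lawPrimitive φ₁ φ₂ (‖(u + τ n • φ : VecLp Ω r) x‖ ^ 2))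
      - ∫ x in Ω, lawPrimitive φ₁ φ₂ (‖u x‖ ^ 2)
      ≤ τ n * ∫ x in Ω, slopeBound φ₁ φ₂ (u x) (φ x) (τ n) := by
    rw [← integral_sub iw iu, ← integral_const_mul]
    refine integral_mono_ae (iw.sub iu) (iS.const_mul _) ?_
    filter_upwards [hae] with x hx
    rw [hx]
    exact h.slope_le_slopeBound hlam _ _ (hτ0 n).le
  have h2 : pairing Ω f₀ (u + τ n • φ : VecLp Ω r) = pairing Ω f₀ u + τ n * pairing Ω f₀ φ := by
    unfold pairing
    rw [← integral_const_mul, ← integral_add (integrable_inner_of_conj Ω hr (Lp.memLp f₀)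
      (Lp.memLp u)) ((integrable_inner_of_conj Ω hr (Lp.memLp f₀) (Lp.memLp φ)).const_mul _)]
    refine integral_congr_ae ?_
    filter_upwards [hae] with x hx
    rw [hx, inner_add_right, real_inner_smul_right]
  have h3 := hmin (τ n) (hτ0 n)
  unfold totalEnergy at h3
  rw [h2] at h3
  exact le_of_mul_le_mul_left (by linarith) (hτ0 n)

theorem integral_slopeBound_zero_eq (h : AdmissibleLaws r φ₁ φ₂) (hlam : φ₁ 1 ≤ φ₂ 1) (hr : 2 ≤ r)
    (u φ : VecLp Ω r) :
    ∫ x in Ω, slopeBound φ₁ φ₂ (u x) (φ x) 0 = pairing Ω (bulkLaw φ₁ φ₂ u) φ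
      + φ₂ 1 * ∫ x in Ω, ‖restrictL2 hr (measurableSet_norm_eq_one u) φ x‖ := by
  have hT := coeFn_restrictL2 hr (measurableSet_norm_eq_one u) φ
  unfold pairing
  rw [← integral_const_mul, ← integral_add
    (integrable_inner_of_conj Ω hr (h.memLp_bulkLaw hlam hr u) (Lp.memLp φ))
    ((((Lp.memLp (restrictL2 hr (measurableSet_norm_eq_one u) φ)).integrable
      (by norm_num)).norm).const_mul _)]
  refine integral_congr_ae ?_
  filter_upwards [hT] with x hx
  rw [hx, bulkLaw_eq_indicator]
  unfold slopeBound
  by_cases hz : ‖u x‖ = 1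
  · simp [indicator, hz, law_of_ge]
  · simp [indicator, hz, real_inner_smul_left]

/-- The Euler-Lagrange equation at a minimizer, with a multiplier on the interface. -/
theorem exists_multiplier (h : AdmissibleLaws r φ₁ φ₂) (hlam : φ₁ 1 ≤ φ₂ 1) (hr : 2 ≤ r)
    (W : Submodule ℝ (VecLp Ω r)) (f₀ : VecLp Ω (conjExp r)) (u : VecLp Ω r)
    (hmin : ∀ φ ∈ W, totalEnergy φ₁ φ₂ f₀ u ≤ totalEnergy φ₁ φ₂ f₀ (u + φ)) :
    ∃ g ∈ combinedLaw φ₁ φ₂ u, ∀ φ : W, pairing Ω g (φ : VecLp Ω r)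
      = pairing Ω f₀ (φ : VecLp Ω r) := by
  have : Fact (1 ≤ ENNReal.ofReal r) :=
    ⟨by rw [← ENNReal.ofReal_one]; exact ENNReal.ofReal_le_ofReal (by linarith)⟩
  have hI := measurableSet_norm_eq_one u
  obtain ⟨L₁, hL₁⟩ := exists_pairing_eq (Ω := Ω) hr (h.memLp_bulkLaw hlam hr u)
  obtain ⟨L₀, hL₀⟩ := exists_pairing_eq (Ω := Ω) hr (Lp.memLp f₀)
  obtain ⟨C, hC0, hC⟩ := exists_integral_norm_le Ω
  have hlam0 : 0 ≤ φ₂ 1 := by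
    rw [← law_of_ge (φ₁ := φ₁) (φ₂ := φ₂) le_rfl]
    exact h.law_nonneg hlam 1
  have hone : ∀ φ ∈ W, (L₀ - L₁) φ ≤ φ₂ 1 * C * ‖restrictL2 hr hI φ‖ := by
    intro φ hφ
    have h1 := h.pairing_le_integral_slopeBound hlam hr f₀ u φ fun t _ =>
      hmin _ (W.smul_mem t hφ)
    rw [h.integral_slopeBound_zero_eq hlam hr, ← hL₀, ← hL₁] at h1
    have h2 := mul_le_mul_of_nonneg_left (hC (restrictL2 hr hI φ)) hlam0
    rw [sub_apply]
    linarith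
  -- The one-sided bound at `φ` and `-φ` controls the absolute value of the residual.
  obtain ⟨k, hk⟩ := exists_inner_eq_of_abs_le ((restrictL2 hr hI).comp W.subtype)
    ((L₀ - L₁).toLinearMap.comp W.subtype) (C := φ₂ 1 * C) fun φ => by
      have h1 := hone φ φ.2
      have h2 := hone (-φ) (W.neg_mem φ.2)
      rw [map_neg, map_neg, norm_neg] at h2
      exact abs_le.2 ⟨by simpa using neg_le.1 h2, h1⟩
  have hk2 : MemLp k (ENNReal.ofReal (conjExp r)) (volume.restrict Ω) :=
    (Lp.memLp k).mono_exponent (by simpa using ENNReal.ofReal_le_ofReal (conjExp_le_two hr))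
  have hkI := hk2.indicator hI
  have hb := h.memLp_bulkLaw hlam hr u
  refine ⟨(hb.add hkI).toLp, ⟨hk2.toLp, ?_⟩, fun φ => ?_⟩
  · filter_upwards [(hb.add hkI).coeFn_toLp, hk2.coeFn_toLp] with x h1 h2
    rw [h1, Pi.add_apply]
    by_cases hx : x ∈ {y | ‖u y‖ = 1}
    · rw [indicator_of_mem hx, indicator_of_mem hx, h2]
    · rw [indicator_of_notMem hx, indicator_of_notMem hx]
  · rw [pairing_congr (hb.add hkI).coeFn_toLp ae_eq_rfl]
    have h1 : L₀ φ - L₁ φ = pairing Ω ({y | ‖u y‖ = 1}.indicator k) (φ : VecLp Ω r) := by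
      have h2 : L₀ φ - L₁ φ = inner ℝ k (restrictL2 hr hI φ) := hk φ
      rw [h2, L2.inner_def]
      refine integral_congr_ae ?_
      filter_upwards [coeFn_restrictL2 hr hI (φ : VecLp Ω r)] with x hx
      rw [hx]
      by_cases hx : x ∈ {y | ‖u y‖ = 1}
      · rw [indicator_of_mem hx, indicator_of_mem hx]
      · rw [indicator_of_notMem hx, indicator_of_notMem hx, inner_zero_right, inner_zero_left]
    have h3 : pairing Ω (bulkLaw φ₁ φ₂ u + {y | ‖u y‖ = 1}.indicator k) (φ : VecLp Ω r)
        = pairing Ω (bulkLaw φ₁ φ₂ u) (φ : VecLp Ω r)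
          + pairing Ω ({y | ‖u y‖ = 1}.indicator k) (φ : VecLp Ω r) := by
      unfold pairing
      rw [← integral_add (integrable_inner_of_conj Ω hr hb (Lp.memLp _))
        (integrable_inner_of_conj Ω hr hkI (Lp.memLp _))]
      refine integral_congr_ae (Eventually.of_forall fun x => ?_)
      simp only [Pi.add_apply, inner_add_left]
    rw [h3, ← h1, ← hL₀, ← hL₁]
    ring

end AdmissibleLaws
end EulerLagrange
end AdaptiveDarcy

/-! ### Local and global minimizers, uniqueness, and the theorem. -/

namespace AdaptiveDarcy

variable {d : ℕ} {Ω : Set (Space d)} {r : ℝ} {φ₁ φ₂ : ℝ → ℝ}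

theorem IsStrongLocalMinimizer.isDirectionalLocalMinimizer {W : Type*} [AddCommGroup W]
    [Module ℝ W] {F : W → ℝ} {v : W} (h : IsStrongLocalMinimizer F v) :
    IsDirectionalLocalMinimizer F v := by
  obtain ⟨η, hη, hF⟩ := h
  exact fun φ => ⟨η, hη, hF φ⟩

/-- Adding an element of `V` does not change the flux data. -/
theorem HasFluxData.add_mem_V {Sv Sp : Set (Space d)} {q u₀ : Space d → ℝ} {u : VecLp Ω r}
    (h : HasFluxData Ω Sv Sp r q u₀ u) (hr : 2 ≤ r) (v : V Ω Sp r hr) :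
    HasFluxData Ω Sv Sp r q u₀ ((v : VecLp Ω r) + u) := by
  have : Fact (1 ≤ ENNReal.ofReal r) :=
    ⟨by rw [← ENNReal.ofReal_one]; exact ENNReal.ofReal_le_ofReal (by linarith)⟩
  intro ψ G g hψ hg
  obtain ⟨L, hL⟩ := exists_pairing_eq (Ω := Ω) hr hψ.isSobolev.memLp_grad
  have hv : pairing Ω G (v : VecLp Ω r) = 0 := v.2 ψ G hψ
  rw [← hL, map_add, hL, hL, hv, zero_add]
  exact h ψ G g hψ hg

variable [IsFiniteMeasure (volume.restrict Ω)]

namespace AdmissibleLaws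

theorem integrable_Psi (h : AdmissibleLaws r φ₁ φ₂) (hlam : φ₁ 1 ≤ φ₂ 1) (hr : 2 ≤ r)
    (u : VecLp Ω r) : Integrable (fun x => Psi φ₁ φ₂ (‖u x‖ ^ 2)) (volume.restrict Ω) :=
  (h.integrable_lawPrimitive hlam hr (Lp.memLp u)).congr
    (Eventually.of_forall fun _ => (Psi_eq_lawPrimitive (sq_nonneg _)).symm)

theorem energy_le_of_isDirectionalLocalMinimizer (h : AdmissibleLaws r φ₁ φ₂)
    (hlam : φ₁ 1 ≤ φ₂ 1) (hr : 2 ≤ r) {W : Submodule ℝ (VecLp Ω r)} (f₀ : VecLp Ω (conjExp r))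
    (uhat : VecLp Ω r) {v : W} (hv : IsDirectionalLocalMinimizer (energy φ₁ φ₂ f₀ uhat) v)
    (w : W) : energy φ₁ φ₂ f₀ uhat v ≤ energy φ₁ φ₂ f₀ uhat w := by
  obtain ⟨η, hη, hF⟩ := hv (w - v)
  -- Any `t` in `(0, η)` with `t ≤ 1` works: the minimum along a short piece of the segment to `w`,
  -- with convexity, gives the comparison at `w`.
  set t := min (η / 2) 1
  have ht0 : 0 < t := lt_min (half_pos hη) one_pos
  have htη : t < η := lt_of_le_of_lt (min_le_left _ _) (half_lt_self hη)
  have h1 := hF t ⟨ht0.le, htη⟩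
  have h2 := h.totalEnergy_segment_le hlam hr f₀ ((v : VecLp Ω r) + uhat) (w + uhat) ht0.le
    (min_le_right _ _)
  have e : (v : VecLp Ω r) + uhat + t • ((w : VecLp Ω r) + uhat - (v + uhat))
      = ((v + t • (w - v) : W) : VecLp Ω r) + uhat := by
    push_cast
    rw [add_sub_add_right_eq_sub]
    abel
  rw [e] at h2
  simp only [energy_eq_totalEnergy] at h1 ⊢
  nlinarith

/-- With `m` the common minimum, `totalEnergy_near` applies for every `ρ`, so the distance is zero.
-/
theorem eq_of_forall_energy_le (h : AdmissibleLaws r φ₁ φ₂)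
    (hlam : φ₁ 1 ≤ φ₂ 1) (hr : 2 ≤ r) {W : Submodule ℝ (VecLp Ω r)} (f₀ : VecLp Ω (conjExp r))
    (uhat : VecLp Ω r) {v w : W}
    (hv : ∀ y : W, energy φ₁ φ₂ f₀ uhat v ≤ energy φ₁ φ₂ f₀ uhat y)
    (hw : ∀ y : W, energy φ₁ φ₂ f₀ uhat w ≤ energy φ₁ φ₂ f₀ uhat y) : w = v := by
  have : Fact (1 ≤ ENNReal.ofReal r) :=
    ⟨by rw [← ENNReal.ofReal_one]; exact ENNReal.ofReal_le_ofReal (by linarith)⟩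
  have hn : ‖(w : VecLp Ω r) - v‖ ≤ 0 := le_of_forall_pos_le_add fun ρ hρ => by
    obtain ⟨δ, hδ, hnear⟩ := h.totalEnergy_near (Ω := Ω) hlam hr f₀ hρ
    have h1 := hv ((2 : ℝ)⁻¹ • (w + v))
    have h2 := hw v
    have e : (((2 : ℝ)⁻¹ • (w + v) : W) : VecLp Ω r) + uhat
        = (2 : ℝ)⁻¹ • (((w : VecLp Ω r) + uhat) + (v + uhat)) := by
      push_cast
      have : uhat = (2 : ℝ)⁻¹ • (uhat + uhat) := by
        rw [← two_smul ℝ uhat, smul_smul]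
        norm_num
      nth_rewrite 1 [this]
      rw [← smul_add]
      congr 1
      abel
    simp only [energy_eq_totalEnergy] at h1 h2
    rw [e] at h1
    have h3 := hnear _ _ _ h1 (by linarith) (by linarith)
    rw [add_sub_add_right_eq_sub] at h3
    linarith
  exact Subtype.ext (sub_eq_zero.1 (norm_le_zero_iff.1 hn))

theorem exists_forall_energy_le [Fact (1 ≤ ENNReal.ofReal r)] (h : AdmissibleLaws r φ₁ φ₂)
    (hlam : φ₁ 1 ≤ φ₂ 1) (hr : 2 ≤ r) {W : Submodule ℝ (VecLp Ω r)}
    (hW : IsClosed (W : Set (VecLp Ω r))) (f₀ : VecLp Ω (conjExp r)) (uhat : VecLp Ω r) :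
    ∃ v : W, ∀ w : W, energy φ₁ φ₂ f₀ uhat v ≤ energy φ₁ φ₂ f₀ uhat w := by
  -- The problem is moved to the affine space `W + û` of total velocities.
  set S : Set (VecLp Ω r) := (fun u => u - uhat) ⁻¹' (W : Set (VecLp Ω r)) with hSdef
  have hS : IsClosed S := hW.preimage (continuous_id.sub continuous_const)
  have hne : S.Nonempty := ⟨uhat, by rw [hSdef, mem_preimage, sub_self]; exact W.zero_mem⟩
  have hmid : ∀ u ∈ S, ∀ w ∈ S, (2 : ℝ)⁻¹ • (u + w) ∈ S := fun u hu w hw => by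
    have e : (2 : ℝ)⁻¹ • (u + w) - uhat = (2 : ℝ)⁻¹ • ((u - uhat) + (w - uhat)) := by
      generalize uhat = z
      module
    rw [hSdef, mem_preimage, e]
    exact W.smul_mem _ (W.add_mem hu hw)
  obtain ⟨u, hu, hmin⟩ := exists_minimizer_of_near hS hne hmid
    (h.exists_le_totalEnergy hlam hr f₀) (fun ρ hρ => h.totalEnergy_near hlam hr f₀ hρ)
    (h.totalEnergy_subgradient hlam hr f₀)
  refine ⟨⟨u - uhat, hu⟩, fun w => ?_⟩
  simp only [energy_eq_totalEnergy, sub_add_cancel]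
  refine hmin _ ?_
  rw [hSdef, mem_preimage, add_sub_cancel_right]
  exact w.2

end AdmissibleLaws
end AdaptiveDarcy

theorem theorem4p1 (d : ℕ) (hd : 1 ≤ d) (Ω Sv Sp : Set (AdaptiveDarcy.Space d))
    (hΩ : AdaptiveDarcy.IsFracture Ω Sv Sp)
    (r : ℝ) (hr : 2 ≤ r) (φ₁ φ₂ : ℝ → ℝ) (hφ : AdaptiveDarcy.AdmissibleLaws r φ₁ φ₂)
    (hlam : φ₁ 1 ≤ φ₂ 1)
    (q u₀ : AdaptiveDarcy.Space d → ℝ)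
    (hq : MemLp q (ENNReal.ofReal r) (volume.restrict Ω))
    (hu₀ : MemLp u₀ (ENNReal.ofReal r) ((AdaptiveDarcy.surface d).restrict Sv))
    (f₀ : AdaptiveDarcy.VecLp Ω (AdaptiveDarcy.conjExp r))
    (uhat : AdaptiveDarcy.VecLp Ω r) :
    -- the energy is given by convergent integrals on all of `V`
    (∀ v : AdaptiveDarcy.V Ω Sp r hr,
      Integrable (fun x => AdaptiveDarcy.Psi φ₁ φ₂
        (‖((v : AdaptiveDarcy.VecLp Ω r) + uhat) x‖ ^ 2)) (volume.restrict Ω) ∧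
      Integrable (fun x => (inner ℝ (f₀ x) (((v : AdaptiveDarcy.VecLp Ω r) + uhat) x) : ℝ))
        (volume.restrict Ω)) ∧
    ∃ v : AdaptiveDarcy.V Ω Sp r hr,
      -- `v` is a global minimizer
      (∀ w : AdaptiveDarcy.V Ω Sp r hr,
        AdaptiveDarcy.energy φ₁ φ₂ f₀ uhat v ≤ AdaptiveDarcy.energy φ₁ φ₂ f₀ uhat w) ∧
      -- `v` is the only local minimizer
      {w : AdaptiveDarcy.V Ω Sp r hr | AdaptiveDarcy.IsStrongLocalMinimizer
        (AdaptiveDarcy.energy φ₁ φ₂ f₀ uhat) w} = {v} ∧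
      (∀ w : AdaptiveDarcy.V Ω Sp r hr, AdaptiveDarcy.IsDirectionalLocalMinimizer
        (AdaptiveDarcy.energy φ₁ φ₂ f₀ uhat) w → w = v) ∧
      -- `v` solves the reduced weak problem
      AdaptiveDarcy.SolvesReducedProblem φ₁ φ₂ f₀ uhat v ∧
      -- `v + û` carries the flux data of `û`
      (AdaptiveDarcy.HasFluxData Ω Sv Sp r q u₀ uhat →
        AdaptiveDarcy.HasFluxData Ω Sv Sp r q u₀ ((v : AdaptiveDarcy.VecLp Ω r) + uhat)) := by
  have : IsFiniteMeasure (volume.restrict Ω) :=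
    isFiniteMeasure_restrict.2 hΩ.isBounded.measure_lt_top.ne
  have : Fact (1 ≤ ENNReal.ofReal r) :=
    ⟨by rw [← ENNReal.ofReal_one]; exact ENNReal.ofReal_le_ofReal (by linarith)⟩
  refine ⟨fun v => ⟨hφ.integrable_Psi hlam hr _,
    AdaptiveDarcy.integrable_inner_of_conj Ω hr (Lp.memLp f₀) (Lp.memLp _)⟩, ?_⟩
  obtain ⟨v, hv⟩ := hφ.exists_forall_energy_le hlam hr (AdaptiveDarcy.isClosed_V Ω Sp hr) f₀ uhat
  have huniq : ∀ w : AdaptiveDarcy.V Ω Sp r hr, AdaptiveDarcy.IsDirectionalLocalMinimizer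
      (AdaptiveDarcy.energy φ₁ φ₂ f₀ uhat) w → w = v := fun w hw =>
    hφ.eq_of_forall_energy_le hlam hr f₀ uhat hv
      (hφ.energy_le_of_isDirectionalLocalMinimizer hlam hr f₀ uhat hw)
  refine ⟨v, hv, ?_, huniq, ?_, fun h => h.add_mem_V hr v⟩
  · ext w
    refine ⟨fun hw => huniq w hw.isDirectionalLocalMinimizer, ?_⟩
    rintro rfl
    exact ⟨1, one_pos, fun φ δ _ => hv _⟩
  · refine hφ.exists_multiplier hlam hr _ f₀ _ fun φ hmem => ?_
    have h1 := hv (v + ⟨φ, hmem⟩)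
    simp only [AdaptiveDarcy.energy_eq_totalEnergy, Submodule.coe_add] at h1
    rwa [add_right_comm] at h1
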